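/- Setting. Let $N\ge 2$, $1\le M\le N$. $M$ agents choose among $N$ arms at times $t=1,2,\dots$. If agent $k$ chooses arm $i$ at time $t$, the realized reward is $r_i^k(t)$, which has law $p_i$ with mean $m_i\ge 0$. The law is sub-Gaussian: $\ln\mathbb E[e^{\beta r_i^k(t)}]\le m_i\beta+\sigma_g^2\beta^2/2$ for all $\beta\in\mathbb R$, where $\sigma_g>0$. The vectors $(r_i^k(t))_{i\le N}$ are independent over all pairs $(t,k)$. The means are pairwise different, $m_{b^1}>m_{b^2}>\dots>m_{b^N}$; put $i^*=b^1$ and $\Delta_{\min}=\min_{i\ne j}|m_i-m_j|$. In the constrained model an agent receives the realized reward only if no other agent chooses the same arm at that time, and nothing otherwise (it still observes the realized value). Let $i^k(t)$ be the arm chosen by agent $k$ at time $t$, and let $\mathbb I_i^k(t)=1$ if agent $k$ is the only agent that chooses arm $i$ at time $t$, and $0$ otherwise. The expected cumulative regret of the group and of agent $k$ are $$R^{\mathrm{con}}(T)=T\sum_{k=1}^M m_{b^k}-\mathbb E\sum_{t=1}^T\sum_{k=1}^M m_{i^k(t)}\mathbb I_{i^k(t)}^k(t),\qquad R^k(T)=\sum_{t=1}^T\Big(m_{b^k}-\mathbb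 E\sum_{i=1}^N r_i^k(t)\mathbf 1\{i^k(t)=i\}\mathbb I_i^k(t)\Big).$$ Communication. The agents are the nodes of a connected undirected graph with Laplacian $L$ and maximal degree $d_{\max}$. Let $P=I-\frac{\kappa}{d_{\max}}L$ with $0<\kappa\le1$ ($P=I$ if $M=1$), with eigenvalues $1=\lambda_1>\lambda_2\ge\dots\ge\lambda_M$, where $\lambda_M>-1$ is assumed, and orthonormal eigenvectors $u_1,\dots,u_M$ with entries $u_p^d$. Put $$\epsilon_n=\sqrt M\sum_{p=2}^M\frac{|\lambda_p|}{1-|\lambda_p|},\qquad \epsilon_c^k=M\sum_{p=1}^M\sum_{j=2}^M\frac{|\lambda_p\lambda_j|}{1-|\lambda_p\lambda_j|}a_{pj}(k).$$ Here, with $\nu^{\pm}_{pj}$ the sum of the positive (respectively negative) numbers among $u_p^du_j^d$, $d=1,\dots,M$: $a_{pj}(k)=\max\{|\nu^-_{pj}|,\nu^+_{pj}\}\,|u_p^ku_j^k|$ if $\lambda_p\lambda_j<0$; otherwise $a_{pj}(k)=\nu^+_{pj}u_p^ku_j^k$ if $u_p^ku_j^k\ge0$, and $a_{pj}(k)=\nu^-_{pj}u_p^ku_j^k$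 if $u_p^ku_j^k\le0$. Algorithm (coop-UCB2-selective-learning). Let $\gamma>1$, $\eta\in(0,4)$, $G(\eta)=1-\eta^2/16$. Let $f$ be strictly increasing and nonnegative on $[1,\infty)$ with $f(t)/\ln t\to0$, such that for each $k$ the set $\{s\ge 1: f(s)\ge\epsilon_c^k\}$ is nonempty; let $t_k^\dagger$ be its infimum (so $t_k^\dagger=f^{-1}(\epsilon_c^k)$ if $\epsilon_c^k\in f([1,\infty))$). The estimates start from $\hat n_i(0)=\hat s_i(0)=0\in\mathbb R^M$ and follow $\hat n_i(t)=P(\hat n_i(t-1)+\xi_i(t))$, $\hat s_i(t)=P(\hat s_i(t-1)+\rho_i(t))$, where $\xi_i^k(t)=\mathbf 1\{i^k(t)=i\}$ and $\rho_i^k(t)=r_i^k(t)\xi_i^k(t)$. For $t\le N$ agent $k$ chooses the arm congruent to $t-1+k$ modulo $N$. For $t>N$ put $$C_i^k=\sigma_g\sqrt{\frac{2\gamma}{G(\eta)}\cdot\frac{\hat n_i^k+f(t-1)}{M\hat n_i^k}\cdot\frac{\ln(t-1)}{\hat n_i^k}},\qquad Q_i^k=\frac{\hat s_i^k}{\hat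 n_i^k}+C_i^k,\qquad W_i^k=\frac{\hat s_i^k}{\hat n_i^k}-C_i^k,$$ with $\hat n_i^k,\hat s_i^k$ taken at time $t-1$, and $Q_i^k=+\infty$, $W_i^k=-\infty$ if $\hat n_i^k=0$. Agent $k$ takes a set of $k$ arms with the $k$ highest values of $Q_i^k$ and chooses in it an arm with the lowest $W_i^k$; ties are broken by any rule that depends only on the past. Claim. For every $T\ge1$, $$R^{\mathrm{con}}(T)\le\sum_{k=1}^MR^k(T)\le m_{i^*}NB+\sum_{k=1}^Mm_{b^k}B,$$ where $$B=\frac{4\sigma_g^2\gamma}{\Delta_{\min}^2G(\eta)}\left(1+\sqrt{1+\frac{\Delta_{\min}^2MG(\eta)}{2\sigma_g^2\gamma}\cdot\frac{f(T)}{\ln T}}\right)\ln T+\bar L$$ (the first summand is read as its limit $0$ if $T=1$) and $$\bar L=\sum_{k=1}^M(t_k^\dagger-1)+M(1+\epsilon_n)+1+\frac{2M(N+1)}{\ln(1+\eta)}\left(\frac1{(\gamma-1)^2}+\frac{\gamma\ln\big((1+\epsilon_n)(1+\eta)\big)}{\gamma-1}+1\right).$$ -/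

import Mathlib

open MeasureTheory ProbabilityTheory

namespace CoopBandit

noncomputable section

/-! ### Communication graph, consensus matrix and graph indices -/

/-- The consensus matrix `P = I - (κ / d_max) L`, with `L` the graph Laplacian.
(For a single agent `L = 0`, so `P = I` whatever `κ / d_max` means.) -/
def consensusMatrix {M : ℕ} (G : SimpleGraph (Fin M)) [DecidableRel G.Adj] (κ : ℝ) :
    Matrix (Fin M) (Fin M) ℝ :=
  1 - (κ / (G.maxDegree : ℝ)) • G.lapMatrix ℝ

/-- `u 0, u 1, …` is an orthonormal basis of eigenvectors of `P`, with eigenvalues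
`lam 0 ≥ lam 1 ≥ …`.  (The index `p` here is `p + 1` in one-based notation.) -/
structure IsEigenbasis {M : ℕ} (P : Matrix (Fin M) (Fin M) ℝ)
    (lam : Fin M → ℝ) (u : Fin M → Fin M → ℝ) : Prop where
  orthonormal : ∀ p q, u p ⬝ᵥ u q = if p = q then 1 else 0
  eigen : ∀ p, P.mulVec (u p) = lam p • u p
  antitone : Antitone lam

/-- The sum of the nonnegative terms of `∑ d, u_p^d u_j^d`. -/
def nuPlus {M : ℕ} (u : Fin M → Fin M → ℝ) (p j : Fin M) : ℝ :=
  ∑ d, if 0 ≤ u p d * u j d then u p d * u j d else 0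

/-- The sum of the nonpositive terms of `∑ d, u_p^d u_j^d`. -/
def nuMinus {M : ℕ} (u : Fin M → Fin M → ℝ) (p j : Fin M) : ℝ :=
  ∑ d, if u p d * u j d ≤ 0 then u p d * u j d else 0

/-- The coefficient `a_{pj}(k)`. -/
def aCoef {M : ℕ} (lam : Fin M → ℝ) (u : Fin M → Fin M → ℝ) (p j k : Fin M) : ℝ :=
  if lam p * lam j < 0 then max |nuMinus u p j| (nuPlus u p j) * |u p k * u j k|
  else if 0 ≤ u p k * u j k then nuPlus u p j * (u p k * u j k)
  else nuMinus u p j * (u p k * u j k)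

/-- The graph explore-exploit index `ε_n`; the sum leaves out the leading eigenvalue. -/
def epsN {M : ℕ} (lam : Fin M → ℝ) : ℝ :=
  √(M : ℝ) * ∑ p ∈ Finset.univ.filter (fun p : Fin M => (p : ℕ) ≠ 0), |lam p| / (1 - |lam p|)

/-- The nodal explore-exploit centrality index `ε_c^k`. -/
def epsC {M : ℕ} (lam : Fin M → ℝ) (u : Fin M → Fin M → ℝ) (k : Fin M) : ℝ :=
  (M : ℝ) * ∑ p : Fin M, ∑ j ∈ Finset.univ.filter (fun j : Fin M => (j : ℕ) ≠ 0),
    |lam p * lam j| / (1 - |lam p * lam j|) * aCoef lam u p j k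

/-! ### Cooperative estimation

Rounds are numbered from `0`: round `n` is time `t = n + 1`, so that the state available to the
agents when they choose in round `n` is the state at time `t - 1 = n`.  Agents and arms are numbered
from `0` as well. -/

/-- `nHat P sel i n k` is `n̂_i^k(n)`: `n̂_i(0) = 0`, `n̂_i(t) = P (n̂_i(t-1) + ξ_i(t))`. -/
def nHat {N M : ℕ} (P : Matrix (Fin M) (Fin M) ℝ) (sel : ℕ → Fin M → Fin N) (i : Fin N) :
    ℕ → Fin M → ℝ
  | 0 => 0
  | n + 1 => P.mulVec (nHat P sel i n + fun k => if sel n k = i then 1 else 0)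

/-- `sHat P r sel i n k` is `ŝ_i^k(n)`: `ŝ_i(0) = 0`, `ŝ_i(t) = P (ŝ_i(t-1) + r_i(t))`, where only
the rewards of the agents that select arm `i` enter. -/
def sHat {N M : ℕ} (P : Matrix (Fin M) (Fin M) ℝ) (r : ℕ → Fin N → Fin M → ℝ)
    (sel : ℕ → Fin M → Fin N) (i : Fin N) : ℕ → Fin M → ℝ
  | 0 => 0
  | n + 1 => P.mulVec (sHat P r sel i n + fun k => r n i k * if sel n k = i then 1 else 0)

/-- `G(η) = 1 - η² / 16`. -/
def gEta (η : ℝ) : ℝ := 1 - η ^ 2 / 16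

/-! ### The algorithm -/

/-- The confidence width `C_i^k(n)` as a function of `x = n̂_i^k(n)`. -/
def confWidth (M : ℕ) (σ γ η : ℝ) (f : ℝ → ℝ) (n : ℕ) (x : ℝ) : ℝ :=
  σ * √(2 * γ / gEta η * ((x + f n) / (M * x)) * (Real.log n / x))

/-- The upper index `Q_i^k(n) = ŝ / n̂ + C`, and `+∞` where the agent has no information yet on
the arm (`n̂ = 0`). -/
def upperIndex {N M : ℕ} (P : Matrix (Fin M) (Fin M) ℝ) (σ γ η : ℝ) (f : ℝ → ℝ)
    (r : ℕ → Fin N → Fin M → ℝ) (sel : ℕ → Fin M → Fin N) (n : ℕ) (k : Fin M) (i : Fin N) :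
    EReal :=
  if nHat P sel i n k = 0 then ⊤
  else ((sHat P r sel i n k / nHat P sel i n k
    + confWidth M σ γ η f n (nHat P sel i n k) : ℝ) : EReal)

/-- The lower index `W_i^k(n) = ŝ / n̂ - C`, and `-∞` where `n̂ = 0`. -/
def lowerIndex {N M : ℕ} (P : Matrix (Fin M) (Fin M) ℝ) (σ γ η : ℝ) (f : ℝ → ℝ)
    (r : ℕ → Fin N → Fin M → ℝ) (sel : ℕ → Fin M → Fin N) (n : ℕ) (k : Fin M) (i : Fin N) :
    EReal :=
  if nHat P sel i n k = 0 then ⊥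
  else ((sHat P r sel i n k / nHat P sel i n k
    - confWidth M σ γ η f n (nHat P sel i n k) : ℝ) : EReal)

/-- `a` minimizes `W` on a set `O` of `c` arms that have the `c` highest values of `Q`
(ties may be broken in any way). -/
def IsSelectiveChoice {N : ℕ} (c : ℕ) (Q W : Fin N → EReal) (a : Fin N) : Prop :=
  ∃ O : Finset (Fin N), O.card = c ∧ (∀ i ∈ O, ∀ j ∉ O, Q j ≤ Q i) ∧
    a ∈ O ∧ ∀ i ∈ O, W a ≤ W i

/-- The selections `sel n k` follow coop-UCB2-selective-learning along the reward path `r`: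
round-robin for `N` rounds, agent `k` starting with the `k`-th arm; then agent `k` (whose one-based
rank is `k + 1`) picks the arm with the lowest `W` among `k + 1` arms with the highest `Q`. -/
structure IsSelectiveLearningRun {N M : ℕ} (P : Matrix (Fin M) (Fin M) ℝ) (σ γ η : ℝ)
    (f : ℝ → ℝ) (r : ℕ → Fin N → Fin M → ℝ) (sel : ℕ → Fin M → Fin N) : Prop where
  init : ∀ n < N, ∀ k : Fin M, (sel n k : ℕ) = (n + k) % N
  select : ∀ n, N ≤ n → ∀ k : Fin M, IsSelectiveChoice ((k : ℕ) + 1)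
    (upperIndex P σ γ η f r sel n k) (lowerIndex P σ γ η f r sel n k) (sel n k)

/-! ### Rewards -/

/-- The probability distribution `p` on `ℝ` is sub-Gaussian with parameter `σ`: its cumulant
generating function is finite and at most `m β + σ² β² / 2`, where `m` is the mean of `p`. -/
def IsSubGaussianLaw (p : Measure ℝ) (σ : ℝ) : Prop :=
  ∀ β : ℝ, Integrable (fun x => Real.exp (β * x)) p ∧
    cgf id p β ≤ (∫ x, x ∂p) * β + σ ^ 2 * β ^ 2 / 2

/-- The sigma-algebra of the rewards before round `n`. -/
abbrev pastRewards {Ω : Type*} {N M : ℕ} (r : ℕ → Fin N → Fin M → Ω → ℝ) (n : ℕ) :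
    MeasurableSpace Ω :=
  ⨆ (s : ℕ) (_ : s < n) (i : Fin N) (k : Fin M),
    MeasurableSpace.comap (r s i k) inferInstance

/-- The choices in each round are determined by the rewards of the earlier rounds (ties included). -/
def DependsOnPast {Ω : Type*} {N M : ℕ} (r : ℕ → Fin N → Fin M → Ω → ℝ)
    (sel : ℕ → Fin M → Ω → Fin N) : Prop :=
  ∀ n k, Measurable[pastRewards r n] (sel n k)

/-! ### Regret in the constrained model -/

/-- The indicator that agent `k` is the only agent to select arm `i` in round `n`. -/
def soleInd {N M : ℕ} (sel : ℕ → Fin M → Fin N) (n : ℕ) (k : Fin M) (i : Fin N) : ℝ :=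
  if sel n k = i ∧ ∀ j, j ≠ k → sel n j ≠ i then 1 else 0

/-- The expected cumulative group regret in the constrained model, where `best k` is the `k`-th
best arm. -/
def groupRegret {Ω : Type*} [MeasurableSpace Ω] {N M : ℕ} (μ : Measure Ω) (m : Fin N → ℝ)
    (best : Fin M → Fin N) (sel : ℕ → Fin M → Ω → Fin N) (T : ℕ) : ℝ :=
  T * ∑ k, m (best k) -
    ∫ ω, ∑ n ∈ Finset.range T, ∑ k,
      m (sel n k ω) * soleInd (fun n k => sel n k ω) n k (sel n k ω) ∂μ

/-- The expected cumulative regret `R^k(T)` of agent `k`. -/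
def agentRegret {Ω : Type*} [MeasurableSpace Ω] {N M : ℕ} (μ : Measure Ω) (m : Fin N → ℝ)
    (best : Fin M → Fin N) (r : ℕ → Fin N → Fin M → Ω → ℝ) (sel : ℕ → Fin M → Ω → Fin N)
    (T : ℕ) (k : Fin M) : ℝ :=
  ∑ n ∈ Finset.range T, (m (best k) -
    ∫ ω, ∑ i, r n i k ω * (if sel n k ω = i then 1 else 0) *
      soleInd (fun n k => sel n k ω) n k i ∂μ)

/-! ### The bound -/

/-- `Δ_min`, the least distance between the means of two different arms. -/
def minGap {N : ℕ} (m : Fin N → ℝ) : ℝ :=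
  ⨅ q : {q : Fin N × Fin N // q.1 ≠ q.2}, |m q.1.1 - m q.1.2|

/-- The inverse of the increasing function `f` on the time axis `[1, ∞)`. -/
def timeInv (f : ℝ → ℝ) (y : ℝ) : ℝ := sInf {s : ℝ | 1 ≤ s ∧ y ≤ f s}

theorem timeInv_eq {f : ℝ → ℝ} (hf : StrictMonoOn f (Set.Ici 1)) {s : ℝ} (hs : 1 ≤ s) :
    timeInv f (f s) = s := by
  have h : {x : ℝ | 1 ≤ x ∧ f s ≤ f x} = Set.Ici s := by
    ext x
    constructor
    · rintro ⟨hx, h⟩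
      exact (hf.le_iff_le hs hx).1 h
    · intro hx
      have hx' : s ≤ x := hx
      exact ⟨hs.trans hx', (hf.le_iff_le hs (hs.trans hx')).2 hx'⟩
  rw [timeInv, h, csInf_Ici]

/-- The part `L̄` of the bound that does not depend on `T`; `tdag k` is `f⁻¹(ε_c^k)`. -/
def lBar (N M : ℕ) (γ η εn : ℝ) (tdag : Fin M → ℝ) : ℝ :=
  ∑ k, (tdag k - 1) + M * (1 + εn) + 1 +
    2 * M * (N + 1) / Real.log (1 + η) *
      (1 / (γ - 1) ^ 2 + γ * Real.log ((1 + εn) * (1 + η)) / (γ - 1) + 1)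

/-- The bound `B` on the number of incorrect selections, with `Δ = Δ_min`. -/
def boundB (N M : ℕ) (σ γ η : ℝ) (f : ℝ → ℝ) (Δ εn : ℝ) (tdag : Fin M → ℝ) (T : ℕ) : ℝ :=
  4 * σ ^ 2 * γ / (Δ ^ 2 * gEta η) *
      (1 + √(1 + Δ ^ 2 * M * gEta η / (2 * σ ^ 2 * γ) * (f T / Real.log T))) * Real.log T +
    lBar N M γ η εn tdag

end

end CoopBandit

/-
Choices depend only on past rewards, so the rewards of a round are independent of the choices made
in it; hence the group regret is the sum of the agents' regrets. An agent loses reward only when it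
misses its target arm, or when another agent selects that arm, so the regret is at most a weighted
count of wrong selections.

If an agent selects a wrong arm whose confidence width is below `Δ_min / 2`, some estimate that
entered the choice lies outside its confidence interval. The width is that small once the arm has
been selected `explorationThreshold + M ε_n` times by the group, because consensus estimates lag
behind the average count by at most `ε_n`.

For the deviations, let `w` be the weights of the rewards in `ŝ - m n̂`. Expanding `P ^ s` in the
eigenbasis gives `∑ w² ≤ (n̂ + ε_c) / M`. Since selections precede their rewards, the exponential
moments telescope to at most `1`, and a peeling over the powers of `1 + η` makes the bound
uniform in the random `n̂`. The peeling needs `n̂ + f` bounded away from `0`: as the agents select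
the arm in distinct rounds of the round robin, `n̂ + ε_c ≥ 3 / 4`.
-/

namespace CoopBandit

/-! ### Spectral theory of the consensus matrix -/

section Eigenbasis

variable {M : ℕ} {P : Matrix (Fin M) (Fin M) ℝ} {lam : Fin M → ℝ} {u : Fin M → Fin M → ℝ}

theorem IsEigenbasis.sum_mul_eq_ite (h : IsEigenbasis P lam u) (k j : Fin M) :
    ∑ p, u p k * u p j = if k = j then 1 else 0 := by
  have h1 : Matrix.of u * (Matrix.of u).transpose = 1 := by
    ext p q
    rw [Matrix.mul_apply, Matrix.one_apply, ← h.orthonormal p q]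
    rfl
  have h2 : ((Matrix.of u).transpose * Matrix.of u) k j = (1 : Matrix (Fin M) (Fin M) ℝ) k j := by
    rw [mul_eq_one_comm.1 h1]
  rwa [Matrix.mul_apply, Matrix.one_apply] at h2

theorem IsEigenbasis.pow_mulVec (h : IsEigenbasis P lam u) (s : ℕ) (p : Fin M) :
    (P ^ s).mulVec (u p) = lam p ^ s • u p := by
  induction s with
  | zero => simp
  | succ s ih =>
    rw [pow_succ, ← Matrix.mulVec_mulVec, h.eigen, Matrix.mulVec_smul, ih, smul_smul, pow_succ,
      mul_comm]

theorem IsEigenbasis.pow_apply (h : IsEigenbasis P lam u) (s : ℕ) (k j : Fin M) :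
    (P ^ s) k j = ∑ p, lam p ^ s * (u p k * u p j) := by
  have expand : Pi.single j (1 : ℝ) = ∑ p, u p j • u p := by
    ext i
    simp [Pi.single_apply, ← h.sum_mul_eq_ite i j, mul_comm]
  calc (P ^ s) k j = (P ^ s).mulVec (Pi.single j 1) k := by simp
    _ = ∑ p, u p j * (lam p ^ s * u p k) := by
      simp [expand, Matrix.mulVec_sum, Matrix.mulVec_smul, h.pow_mulVec]
    _ = ∑ p, lam p ^ s * (u p k * u p j) := Finset.sum_congr rfl fun p _ => by ring

theorem IsEigenbasis.isSymm (h : IsEigenbasis P lam u) : P.IsSymm := by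
  ext k j
  rw [Matrix.transpose_apply, ← pow_one P, h.pow_apply, h.pow_apply]
  exact Finset.sum_congr rfl fun p _ => by ring

theorem IsEigenbasis.sum_sq (h : IsEigenbasis P lam u) (p : Fin M) : ∑ j, u p j ^ 2 = 1 := by
  simpa [dotProduct, sq] using h.orthonormal p p

theorem IsEigenbasis.abs_le_one (h : IsEigenbasis P lam u) (p k : Fin M) : |u p k| ≤ 1 := by
  rw [← sq_le_one_iff_abs_le_one, ← h.sum_sq p]
  exact Finset.single_le_sum (f := fun j => u p j ^ 2) (fun j _ => sq_nonneg _) (Finset.mem_univ k)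

theorem IsEigenbasis.abs_mul_sum_le (h : IsEigenbasis P lam u) (p k : Fin M) {ξ : Fin M → ℝ}
    (hξ : ∀ j, ξ j ∈ Set.Icc 0 1) : |u p k * ∑ j, u p j * ξ j| ≤ √(M : ℝ) := by
  have hξM : ∑ j, ξ j ^ 2 ≤ M := by
    calc ∑ j, ξ j ^ 2 ≤ ∑ _j : Fin M, (1 : ℝ) := by
          gcongr with j _
          exact pow_le_one₀ (hξ j).1 (hξ j).2
      _ = M := by simp
  have hsum : |∑ j, u p j * ξ j| ≤ √(M : ℝ) := by
    refine Real.abs_le_sqrt ((Finset.sum_mul_sq_le_sq_mul_sq _ _ _).trans ?_)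
    rwa [h.sum_sq, one_mul]
  rw [abs_mul]
  exact (mul_le_of_le_one_left (abs_nonneg _) (h.abs_le_one p k)).trans hsum

theorem IsEigenbasis.mul_eq_inv_of_const (h : IsEigenbasis P lam u) {p : Fin M}
    (hp : ∀ i j, u p i = u p j) (k j : Fin M) : u p k * u p j = 1 / M := by
  have hM : (0 : ℝ) < M := by exact_mod_cast k.pos
  have hsum := h.sum_sq p
  rw [Finset.sum_congr rfl fun i _ => by rw [hp i k]] at hsum
  simp only [Finset.sum_const, Finset.card_univ, Fintype.card_fin, nsmul_eq_mul] at hsum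
  rw [hp j k]
  field_simp
  linarith

theorem IsEigenbasis.eq_of_const (h : IsEigenbasis P lam u) {p q : Fin M}
    (hp : ∀ i j, u p i = u p j) (hq : ∀ i j, u q i = u q j) : p = q := by
  by_contra hpq
  have hM : (M : ℝ) ≠ 0 := by exact_mod_cast p.pos.ne'
  have horth := h.orthonormal p q
  rw [if_neg hpq, dotProduct, Finset.sum_congr rfl fun i _ => by rw [hp i p, hq i p]] at horth
  have hzero : u p p * u q p = 0 := by simpa [hM] using horth
  have hsq : (u p p * u p p) * (u q p * u q p) = 0 := by
    linear_combination (u p p * u q p) * hzero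
  rw [h.mul_eq_inv_of_const hp, h.mul_eq_inv_of_const hq] at hsq
  simp [hM] at hsq

theorem IsEigenbasis.one_sub_mul_sum_eq_zero (h : IsEigenbasis P lam u)
    (h1 : P.mulVec (fun _ => 1) = fun _ => 1) (p : Fin M) : (1 - lam p) * ∑ k, u p k = 0 := by
  have hsum : u p ⬝ᵥ (fun _ => (1 : ℝ)) = ∑ k, u p k := by simp [dotProduct]
  have heigen : u p ⬝ᵥ P.mulVec (fun _ => (1 : ℝ)) = lam p * (u p ⬝ᵥ fun _ => (1 : ℝ)) := by
    rw [Matrix.dotProduct_mulVec, ← Matrix.mulVec_transpose, h.isSymm.eq, h.eigen, smul_dotProduct,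
      smul_eq_mul]
  rw [h1, hsum] at heigen
  linarith

/-- The indices of the eigenvalues other than the leading one, written as in `epsN` and `epsC`. -/
abbrev nonleading (M : ℕ) : Finset (Fin M) :=
  Finset.univ.filter (fun p : Fin M => (p : ℕ) ≠ 0)

theorem mem_nonleading {p : Fin M} : p ∈ nonleading M ↔ (p : ℕ) ≠ 0 := by
  simp

theorem sum_eq_add_sum_nonleading {z : Fin M} (hz : (z : ℕ) = 0) (g : Fin M → ℝ) :
    ∑ p, g p = g z + ∑ p ∈ nonleading M, g p := by
  have herase : nonleading M = Finset.univ.erase z := by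
    ext p
    simp [Fin.ext_iff, hz]
  rw [herase, Finset.add_sum_erase _ _ (Finset.mem_univ z)]

end Eigenbasis

section ConsensusSpectrum

variable {M : ℕ} {P : Matrix (Fin M) (Fin M) ℝ} {lam : Fin M → ℝ} {u : Fin M → Fin M → ℝ}

/-- An eigenbasis of a stochastic matrix whose eigenvalues other than the leading one lie in
`(-1, 1)`: what running consensus needs to know about the communication matrix. -/
structure IsConsensusSpectrum (P : Matrix (Fin M) (Fin M) ℝ) (lam : Fin M → ℝ)
    (u : Fin M → Fin M → ℝ) : Prop extends IsEigenbasis P lam u where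
  nonneg : ∀ k j, 0 ≤ P k j
  mulVec_one : P.mulVec (fun _ => 1) = fun _ => 1
  abs_lt_one : ∀ p : Fin M, (p : ℕ) ≠ 0 → |lam p| < 1

namespace IsConsensusSpectrum

theorem pow_nonneg (h : IsConsensusSpectrum P lam u) (s : ℕ) (k j : Fin M) :
    0 ≤ (P ^ s) k j := by
  induction s generalizing k j with
  | zero => rw [pow_zero, Matrix.one_apply]; split_ifs <;> simp
  | succ s ih =>
    rw [pow_succ, Matrix.mul_apply]
    exact Finset.sum_nonneg fun i _ => mul_nonneg (ih k i) (h.nonneg i j)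

theorem sum_pow_apply (h : IsConsensusSpectrum P lam u) (s : ℕ) (k : Fin M) :
    ∑ j, (P ^ s) k j = 1 := by
  have hpow : (P ^ s).mulVec (fun _ => 1) = fun _ => 1 := by
    induction s with
    | zero => simp
    | succ s ih => rw [pow_succ, ← Matrix.mulVec_mulVec, h.mulVec_one, ih]
  simpa [Matrix.mulVec, dotProduct] using congrFun hpow k

theorem sum_eq_zero (h : IsConsensusSpectrum P lam u) {p : Fin M} (hp : (p : ℕ) ≠ 0) :
    ∑ k, u p k = 0 := by
  have hlt := (abs_lt.1 (h.abs_lt_one p hp)).2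
  exact (mul_eq_zero.1 (h.one_sub_mul_sum_eq_zero h.mulVec_one p)).resolve_left (by linarith)

theorem leading_mul_sum (h : IsConsensusSpectrum P lam u) {z : Fin M} (hz : (z : ℕ) = 0)
    (k : Fin M) : u z k * ∑ j, u z j = 1 := by
  have hcomplete : ∑ p, u p k * ∑ j, u p j = 1 := by
    simp_rw [Finset.mul_sum]
    rw [Finset.sum_comm]
    simp [h.sum_mul_eq_ite]
  have htail : ∑ p ∈ nonleading M, u p k * ∑ j, u p j = 0 :=
    Finset.sum_eq_zero fun p hp => by rw [h.sum_eq_zero (mem_nonleading.1 hp), mul_zero]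
  rwa [sum_eq_add_sum_nonleading hz, htail, add_zero] at hcomplete

theorem leading_const (h : IsConsensusSpectrum P lam u) {z : Fin M} (hz : (z : ℕ) = 0)
    (i j : Fin M) : u z i = u z j := by
  rw [eq_one_div_of_mul_eq_one_left (h.leading_mul_sum hz i),
    eq_one_div_of_mul_eq_one_left (h.leading_mul_sum hz j)]

theorem leading_eigenvalue (h : IsConsensusSpectrum P lam u) {z : Fin M} (hz : (z : ℕ) = 0) :
    lam z = 1 := by
  have hsum : ∑ j, u z j ≠ 0 := right_ne_zero_of_mul_eq_one (h.leading_mul_sum hz z)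
  have hprod := (mul_eq_zero.1 (h.one_sub_mul_sum_eq_zero h.mulVec_one z)).resolve_right hsum
  linarith

theorem abs_le_one (h : IsConsensusSpectrum P lam u) (p : Fin M) : |lam p| ≤ 1 := by
  by_cases hp : (p : ℕ) = 0
  · rw [h.leading_eigenvalue hp, abs_one]
  · exact (h.abs_lt_one p hp).le

theorem abs_mul_lt_one (h : IsConsensusSpectrum P lam u) (p : Fin M) {w : Fin M}
    (hw : (w : ℕ) ≠ 0) : |lam p * lam w| < 1 := by
  rw [abs_mul]
  exact (mul_le_of_le_one_left (abs_nonneg _) (h.abs_le_one p)).trans_lt (h.abs_lt_one w hw)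

theorem pow_apply_eq_inv_add (h : IsConsensusSpectrum P lam u) (s : ℕ) (k j : Fin M) :
    (P ^ s) k j = 1 / M + ∑ p ∈ nonleading M, lam p ^ s * (u p k * u p j) := by
  have hz : ((⟨0, k.pos⟩ : Fin M) : ℕ) = 0 := rfl
  rw [h.pow_apply, sum_eq_add_sum_nonleading hz, h.leading_eigenvalue hz,
    h.mul_eq_inv_of_const (h.leading_const hz), one_pow, one_mul]

theorem epsN_nonneg (h : IsConsensusSpectrum P lam u) : 0 ≤ epsN lam := by
  refine mul_nonneg (Real.sqrt_nonneg _) (Finset.sum_nonneg fun p hp => ?_)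
  have := h.abs_lt_one p (mem_nonleading.1 hp)
  exact div_nonneg (abs_nonneg _) (by linarith)

end IsConsensusSpectrum

variable (G : SimpleGraph (Fin M)) [DecidableRel G.Adj] {κ : ℝ}

theorem consensusMatrix_nonneg (hκ0 : 0 ≤ κ) (hκ1 : κ ≤ 1) (k j : Fin M) :
    0 ≤ consensusMatrix G κ k j := by
  have hc : 0 ≤ κ / (G.maxDegree : ℝ) := by positivity
  rw [consensusMatrix, Matrix.sub_apply, Matrix.smul_apply, SimpleGraph.lapMatrix,
    Matrix.sub_apply, SimpleGraph.degMatrix, smul_eq_mul]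
  by_cases hkj : k = j
  · subst hkj
    have hdeg : (G.degree k : ℝ) ≤ G.maxDegree := by exact_mod_cast G.degree_le_maxDegree k
    have hdiag : κ / (G.maxDegree : ℝ) * G.degree k ≤ 1 := by
      rw [div_mul_eq_mul_div]
      exact div_le_one_of_le₀ ((mul_le_of_le_one_left (Nat.cast_nonneg _) hκ1).trans hdeg)
        (Nat.cast_nonneg _)
    simpa using hdiag
  · rw [Matrix.one_apply_ne hkj, Matrix.diagonal_apply_ne _ hkj, SimpleGraph.adjMatrix_apply]
    split_ifs <;> simp [hc]

theorem consensusMatrix_mulVec_one (κ : ℝ) :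
    (consensusMatrix G κ).mulVec (fun _ => 1) = fun _ => 1 := by
  rw [consensusMatrix, Matrix.sub_mulVec, Matrix.smul_mulVec,
    SimpleGraph.lapMatrix_mulVec_const_eq_zero]
  simp

variable {G}

theorem IsEigenbasis.eq_one_sub_lapMatrix (h : IsEigenbasis (consensusMatrix G κ) lam u)
    (p : Fin M) : lam p = 1 - κ / (G.maxDegree : ℝ) *
      Matrix.toLinearMap₂' ℝ (G.lapMatrix ℝ) (u p) (u p) := by
  have hquad : u p ⬝ᵥ (consensusMatrix G κ).mulVec (u p) = lam p := by
    rw [h.eigen, dotProduct_smul, h.orthonormal]; simp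
  rw [← hquad, consensusMatrix, Matrix.sub_mulVec, Matrix.smul_mulVec, dotProduct_sub,
    Matrix.one_mulVec, h.orthonormal, dotProduct_smul, Matrix.toLinearMap₂'_apply']
  simp

theorem IsEigenbasis.le_one (h : IsEigenbasis (consensusMatrix G κ) lam u) (hκ : 0 ≤ κ)
    (p : Fin M) : lam p ≤ 1 := by
  have hquad : 0 ≤ Matrix.toLinearMap₂' ℝ (G.lapMatrix ℝ) (u p) (u p) := by
    rw [SimpleGraph.lapMatrix_toLinearMap₂']; positivity
  have : 0 ≤ κ / (G.maxDegree : ℝ) * Matrix.toLinearMap₂' ℝ (G.lapMatrix ℝ) (u p) (u p) := by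
    positivity
  linarith [h.eq_one_sub_lapMatrix p]

theorem IsEigenbasis.const_of_eq_one (h : IsEigenbasis (consensusMatrix G κ) lam u)
    (hG : G.Connected) (hκ : 0 < κ) {p : Fin M} (hp : lam p = 1) (i j : Fin M) :
    u p i = u p j := by
  by_cases hij : i = j
  · rw [hij]
  have : Nontrivial (Fin M) := ⟨i, j, hij⟩
  have hdeg : 0 < G.maxDegree :=
    (hG.preconnected.degree_pos_of_nontrivial i).trans_le (G.degree_le_maxDegree i)
  have hc : κ / (G.maxDegree : ℝ) ≠ 0 := by positivity
  have hquad : Matrix.toLinearMap₂' ℝ (G.lapMatrix ℝ) (u p) (u p) = 0 := by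
    have := h.eq_one_sub_lapMatrix p
    exact (mul_eq_zero.1 (by linarith :
      κ / (G.maxDegree : ℝ) * Matrix.toLinearMap₂' ℝ (G.lapMatrix ℝ) (u p) (u p) = 0)).resolve_left
      hc
  exact (G.lapMatrix_toLinearMap₂'_apply'_eq_zero_iff_forall_reachable (u p)).1 hquad i j
    (hG.preconnected i j)

theorem IsEigenbasis.isConsensusSpectrum (h : IsEigenbasis (consensusMatrix G κ) lam u)
    (hG : G.Connected) (hκ0 : 0 < κ) (hκ1 : κ ≤ 1) (hlam : ∀ p, -1 < lam p) :
    IsConsensusSpectrum (consensusMatrix G κ) lam u where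
  toIsEigenbasis := h
  nonneg := consensusMatrix_nonneg G hκ0.le hκ1
  mulVec_one := consensusMatrix_mulVec_one G κ
  abs_lt_one p hp := by
    refine abs_lt.2 ⟨hlam p, lt_of_le_of_ne (h.le_one hκ0.le p) fun hp1 => hp ?_⟩
    let z : Fin M := ⟨0, p.pos⟩
    have hz1 : lam z = 1 :=
      le_antisymm (h.le_one hκ0.le z) (hp1 ▸ h.antitone (Nat.zero_le (p : ℕ)))
    rw [h.eq_of_const (h.const_of_eq_one hG hκ0 hp1) (h.const_of_eq_one hG hκ0 hz1)]

end ConsensusSpectrum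

/-! ### Running consensus -/

section RunningConsensus

/-- The state at time `n` of the recursion `x 0 = 0`, `x (n + 1) = P (x n + y n)`, solved. Both
`nHat` and `sHat` are of this form. -/
noncomputable def runningConsensus {M : ℕ} (P : Matrix (Fin M) (Fin M) ℝ) (y : ℕ → Fin M → ℝ)
    (n : ℕ) (k : Fin M) : ℝ :=
  ∑ τ ∈ Finset.range n, ∑ j, (P ^ (n - τ)) k j * y τ j

/-- The indicator `ξ_i^k` that agent `k` selects arm `i` in round `n`. -/
def selInd {N M : ℕ} (sel : ℕ → Fin M → Fin N) (i : Fin N) (n : ℕ) (k : Fin M) : ℝ :=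
  if sel n k = i then 1 else 0

theorem selInd_mem_Icc {N M : ℕ} (sel : ℕ → Fin M → Fin N) (i : Fin N) (n : ℕ) (k : Fin M) :
    selInd sel i n k ∈ Set.Icc 0 1 := by
  rw [selInd]
  split_ifs <;> simp

theorem eq_runningConsensus {M : ℕ} {P : Matrix (Fin M) (Fin M) ℝ} {x y : ℕ → Fin M → ℝ}
    (h0 : x 0 = 0) (hs : ∀ n, x (n + 1) = P.mulVec (x n + y n)) : x = runningConsensus P y := by
  have hpow : ∀ n, x n = ∑ τ ∈ Finset.range n, (P ^ (n - τ)).mulVec (y τ) := by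
    intro n
    induction n with
    | zero => simp [h0]
    | succ n ih =>
      rw [hs, Matrix.mulVec_add, ih, Matrix.mulVec_sum, Finset.sum_range_succ]
      congr 1
      · refine Finset.sum_congr rfl fun τ hτ => ?_
        rw [Matrix.mulVec_mulVec, ← pow_succ', Nat.sub_add_comm (Finset.mem_range.1 hτ).le]
      · simp
  ext n k
  rw [hpow n, Finset.sum_apply]
  rfl

theorem nHat_eq_runningConsensus {N M : ℕ} (P : Matrix (Fin M) (Fin M) ℝ)
    (sel : ℕ → Fin M → Fin N) (i : Fin N) :
    nHat P sel i = runningConsensus P (selInd sel i) :=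
  eq_runningConsensus rfl fun _ => rfl

theorem sHat_eq_runningConsensus {N M : ℕ} (P : Matrix (Fin M) (Fin M) ℝ)
    (r : ℕ → Fin N → Fin M → ℝ) (sel : ℕ → Fin M → Fin N) (i : Fin N) :
    sHat P r sel i = runningConsensus P fun n k => r n i k * selInd sel i n k :=
  eq_runningConsensus rfl fun _ => rfl

theorem sum_pow_sub_le {q : ℝ} (h0 : 0 ≤ q) (h1 : q < 1) (n : ℕ) :
    ∑ τ ∈ Finset.range n, q ^ (n - τ) ≤ q / (1 - q) := by
  have h1' : 0 < 1 - q := by linarith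
  induction n with
  | zero => simpa using div_nonneg h0 h1'.le
  | succ n ih =>
    calc ∑ τ ∈ Finset.range (n + 1), q ^ (n + 1 - τ)
        = q * (∑ τ ∈ Finset.range n, q ^ (n - τ) + 1) := by
          rw [Finset.sum_range_succ, mul_add, Finset.mul_sum]
          congr 1
          · refine Finset.sum_congr rfl fun τ hτ => ?_
            rw [← pow_succ', Nat.sub_add_comm (Finset.mem_range.1 hτ).le]
          · simp
      _ ≤ q * (q / (1 - q) + 1) := by gcongr
      _ = q / (1 - q) := by field_simp; ring

theorem abs_sum_pow_sub_mul_le {q C : ℝ} (hq : |q| < 1) {x : ℕ → ℝ} (hx : ∀ τ, |x τ| ≤ C)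
    (n : ℕ) : |∑ τ ∈ Finset.range n, q ^ (n - τ) * x τ| ≤ C * (|q| / (1 - |q|)) := by
  have hC : 0 ≤ C := (abs_nonneg _).trans (hx 0)
  calc |∑ τ ∈ Finset.range n, q ^ (n - τ) * x τ|
      ≤ ∑ τ ∈ Finset.range n, |q| ^ (n - τ) * C := by
        refine (Finset.abs_sum_le_sum_abs _ _).trans ?_
        gcongr with τ
        rw [abs_mul, abs_pow]
        gcongr
        exact hx τ
    _ ≤ |q| / (1 - |q|) * C := by
        rw [← Finset.sum_mul]
        gcongr
        exact sum_pow_sub_le (abs_nonneg q) hq n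
    _ = C * (|q| / (1 - |q|)) := mul_comm _ _

theorem sum_pow_sub_le_of_injective {ι : Type*} [Fintype ι] {q : ℝ} (h0 : 0 ≤ q) (h1 : q < 1)
    {n : ℕ} {t : ι → ℕ} (ht : Function.Injective t) (htn : ∀ j, t j < n) :
    ∑ j, q ^ (n - t j) ≤ q / (1 - q) := by
  classical
  refine le_trans ?_ (sum_pow_sub_le h0 h1 n)
  rw [← Finset.sum_image (f := fun τ => q ^ (n - τ)) ht.injOn]
  refine Finset.sum_le_sum_of_subset_of_nonneg (fun τ hτ => ?_) fun _ _ _ => by positivity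
  obtain ⟨j, -, rfl⟩ := Finset.mem_image.1 hτ
  exact Finset.mem_range.2 (htn j)

variable {M : ℕ} {P : Matrix (Fin M) (Fin M) ℝ} {lam : Fin M → ℝ} {u : Fin M → Fin M → ℝ}

theorem nuPlus_nonneg (u : Fin M → Fin M → ℝ) (p j : Fin M) : 0 ≤ nuPlus u p j :=
  Finset.sum_nonneg fun d _ => by split_ifs with h <;> simp [h]

theorem nuMinus_nonpos (u : Fin M → Fin M → ℝ) (p j : Fin M) : nuMinus u p j ≤ 0 :=
  Finset.sum_nonpos fun d _ => by split_ifs with h <;> simp [h]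

theorem aCoef_nonneg (lam : Fin M → ℝ) (u : Fin M → Fin M → ℝ) (p j k : Fin M) :
    0 ≤ aCoef lam u p j k := by
  have hplus := nuPlus_nonneg u p j
  have hminus := nuMinus_nonpos u p j
  rw [aCoef]
  split_ifs with hlam hu
  · positivity
  · positivity
  · exact mul_nonneg_of_nonpos_of_nonpos hminus (not_le.1 hu).le

theorem sum_mul_mem_Icc (u : Fin M → Fin M → ℝ) (p j : Fin M) {ξ : Fin M → ℝ}
    (hξ : ∀ d, ξ d ∈ Set.Icc 0 1) :
    ∑ d, u p d * u j d * ξ d ∈ Set.Icc (nuMinus u p j) (nuPlus u p j) := by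
  constructor <;> refine Finset.sum_le_sum fun d _ => ?_ <;> obtain ⟨hξ0, hξ1⟩ := hξ d
  · split_ifs with h
    · nlinarith
    · exact mul_nonneg (not_le.1 h).le hξ0
  · split_ifs with h
    · exact mul_le_of_le_one_right h hξ1
    · exact mul_nonpos_of_nonpos_of_nonneg (not_le.1 h).le hξ0

theorem pow_mul_le_aCoef (lam : Fin M → ℝ) (u : Fin M → Fin M → ℝ) (p j k : Fin M) {ξ : Fin M → ℝ}
    (hξ : ∀ d, ξ d ∈ Set.Icc 0 1) (s : ℕ) :
    (lam p * lam j) ^ s * ((u p k * u j k) * ∑ d, u p d * u j d * ξ d)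
      ≤ |lam p * lam j| ^ s * aCoef lam u p j k := by
  obtain ⟨hminus, hplus⟩ := sum_mul_mem_Icc u p j hξ
  rw [aCoef]
  split_ifs with hlam hu
  · refine (le_abs_self _).trans ?_
    rw [abs_mul, abs_pow, abs_mul (u p k * u j k), mul_comm (|u p k * u j k|)]
    gcongr
    exact abs_le_max_abs_abs hminus hplus |>.trans_eq (by rw [abs_of_nonneg (nuPlus_nonneg u p j)])
  · rw [not_lt] at hlam
    rw [abs_of_nonneg hlam, mul_comm (nuPlus u p j)]
    gcongr
  · rw [not_lt] at hlam
    rw [abs_of_nonneg hlam, mul_comm (nuMinus u p j)]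
    exact mul_le_mul_of_nonneg_left (mul_le_mul_of_nonpos_left hminus (not_le.1 hu).le)
      (by positivity)

namespace IsConsensusSpectrum

variable {ξ : ℕ → Fin M → ℝ}

theorem runningConsensus_nonneg (h : IsConsensusSpectrum P lam u) (hξ : ∀ τ j, 0 ≤ ξ τ j)
    (n : ℕ) (k : Fin M) : 0 ≤ runningConsensus P ξ n k :=
  Finset.sum_nonneg fun τ _ => Finset.sum_nonneg fun j _ =>
    mul_nonneg (h.pow_nonneg _ _ _) (hξ τ j)

theorem runningConsensus_le (h : IsConsensusSpectrum P lam u) (hξ : ∀ τ j, ξ τ j ≤ 1)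
    (n : ℕ) (k : Fin M) : runningConsensus P ξ n k ≤ n := by
  calc runningConsensus P ξ n k ≤ ∑ τ ∈ Finset.range n, ∑ j, (P ^ (n - τ)) k j := by
        rw [runningConsensus]
        gcongr with τ _ j
        exact mul_le_of_le_one_right (h.pow_nonneg _ _ _) (hξ τ j)
    _ = n := by simp [h.sum_pow_apply]

theorem runningConsensus_eq_average_add (h : IsConsensusSpectrum P lam u) (y : ℕ → Fin M → ℝ)
    (n : ℕ) (k : Fin M) :
    runningConsensus P y n k = 1 / M * ∑ τ ∈ Finset.range n, ∑ j, y τ j +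
      ∑ p ∈ nonleading M, ∑ τ ∈ Finset.range n, lam p ^ (n - τ) * (u p k * ∑ j, u p j * y τ j) := by
  rw [runningConsensus, Finset.sum_comm (s := nonleading M), Finset.mul_sum,
    ← Finset.sum_add_distrib]
  refine Finset.sum_congr rfl fun τ _ => ?_
  simp only [h.pow_apply_eq_inv_add, add_mul, Finset.sum_add_distrib, Finset.mul_sum,
    Finset.sum_mul]
  congr 1
  rw [Finset.sum_comm]
  exact Finset.sum_congr rfl fun p _ => Finset.sum_congr rfl fun j _ => by ring

theorem sum_le_runningConsensus (h : IsConsensusSpectrum P lam u)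
    (hξ : ∀ τ j, ξ τ j ∈ Set.Icc 0 1) (n : ℕ) (k : Fin M) :
    ∑ τ ∈ Finset.range n, ∑ j, ξ τ j ≤ M * (runningConsensus P ξ n k + epsN lam) := by
  have hM : (0 : ℝ) < M := by exact_mod_cast k.pos
  have htail : -epsN lam ≤ ∑ p ∈ nonleading M,
      ∑ τ ∈ Finset.range n, lam p ^ (n - τ) * (u p k * ∑ j, u p j * ξ τ j) := by
    rw [epsN, Finset.mul_sum, ← Finset.sum_neg_distrib]
    exact Finset.sum_le_sum fun p hp => neg_le_of_abs_le <|
      abs_sum_pow_sub_mul_le (h.abs_lt_one p (mem_nonleading.1 hp))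
        (fun τ => h.abs_mul_sum_le p k (hξ τ)) n
  rw [h.runningConsensus_eq_average_add]
  calc ∑ τ ∈ Finset.range n, ∑ j, ξ τ j
      = M * (1 / M * ∑ τ ∈ Finset.range n, ∑ j, ξ τ j) := by field_simp
    _ ≤ _ := by gcongr; linarith

theorem mul_sq_pow_apply (h : IsConsensusSpectrum P lam u) (s : ℕ) (k j : Fin M) :
    M * (P ^ s) k j ^ 2 = (P ^ s) k j + M * ∑ p, ∑ w ∈ nonleading M,
      (lam p * lam w) ^ s * ((u p k * u w k) * (u p j * u w j)) := by
  have hM : (0 : ℝ) < M := by exact_mod_cast k.pos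
  have hprod : ∑ p, ∑ w ∈ nonleading M,
      (lam p * lam w) ^ s * ((u p k * u w k) * (u p j * u w j))
      = (P ^ s) k j * ∑ w ∈ nonleading M, lam w ^ s * (u w k * u w j) := by
    rw [h.pow_apply, Finset.sum_mul_sum]
    exact Finset.sum_congr rfl fun p _ => Finset.sum_congr rfl fun w _ => by
      rw [mul_pow]; ring
  rw [hprod, eq_sub_of_add_eq' (h.pow_apply_eq_inv_add s k j).symm]
  field_simp
  ring

theorem mul_sum_sq_pow_apply_le (h : IsConsensusSpectrum P lam u) {x : Fin M → ℝ}
    (hx : ∀ j, x j ∈ Set.Icc 0 1) (s : ℕ) (k : Fin M) :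
    M * ∑ j, (P ^ s) k j ^ 2 * x j ≤ ∑ j, (P ^ s) k j * x j +
      M * ∑ p, ∑ w ∈ nonleading M, |lam p * lam w| ^ s * aCoef lam u p w k := by
  calc M * ∑ j, (P ^ s) k j ^ 2 * x j
      = ∑ j, (P ^ s) k j * x j + M * ∑ p, ∑ w ∈ nonleading M,
          (lam p * lam w) ^ s * ((u p k * u w k) * ∑ j, u p j * u w j * x j) := by
        simp only [Finset.mul_sum, ← mul_assoc, h.mul_sq_pow_apply, add_mul, Finset.sum_mul,
          Finset.sum_add_distrib]
        congr 1
        rw [Finset.sum_comm]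
        refine Finset.sum_congr rfl fun p _ => ?_
        rw [Finset.sum_comm]
    _ ≤ _ := by
        gcongr _ + _ * ?_
        exact Finset.sum_le_sum fun p _ => Finset.sum_le_sum fun w _ =>
          pow_mul_le_aCoef lam u p w k hx s

theorem mul_sum_sq_le_runningConsensus (h : IsConsensusSpectrum P lam u)
    (hξ : ∀ τ j, ξ τ j ∈ Set.Icc 0 1) (n : ℕ) (k : Fin M) :
    M * ∑ τ ∈ Finset.range n, ∑ j, (P ^ (n - τ)) k j ^ 2 * ξ τ j ≤
      runningConsensus P ξ n k + epsC lam u k := by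
  calc M * ∑ τ ∈ Finset.range n, ∑ j, (P ^ (n - τ)) k j ^ 2 * ξ τ j
      ≤ ∑ τ ∈ Finset.range n, (∑ j, (P ^ (n - τ)) k j * ξ τ j +
          M * ∑ p, ∑ w ∈ nonleading M, |lam p * lam w| ^ (n - τ) * aCoef lam u p w k) := by
        rw [Finset.mul_sum]
        exact Finset.sum_le_sum fun τ _ => h.mul_sum_sq_pow_apply_le (hξ τ) (n - τ) k
    _ = runningConsensus P ξ n k + M * ∑ p, ∑ w ∈ nonleading M,
          (∑ τ ∈ Finset.range n, |lam p * lam w| ^ (n - τ)) * aCoef lam u p w k := by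
        rw [Finset.sum_add_distrib, ← Finset.mul_sum, Finset.sum_comm, runningConsensus]
        simp_rw [Finset.sum_comm (s := Finset.range n), Finset.sum_mul]
    _ ≤ runningConsensus P ξ n k + epsC lam u k := by
        rw [epsC]
        gcongr with p _ w hw
        · exact aCoef_nonneg lam u p w k
        · exact sum_pow_sub_le (abs_nonneg _) (h.abs_mul_lt_one p (mem_nonleading.1 hw)) n

theorem le_epsC (h : IsConsensusSpectrum P lam u) (k : Fin M) :
    M * ∑ p ∈ nonleading M, lam p ^ 2 / (1 - lam p ^ 2) * u p k ^ 2 ≤ epsC lam u k := by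
  have hterm : ∀ p, ∀ w ∈ nonleading M,
      0 ≤ |lam p * lam w| / (1 - |lam p * lam w|) * aCoef lam u p w k := fun p w hw =>
    mul_nonneg (div_nonneg (abs_nonneg _)
      (sub_nonneg.2 (h.abs_mul_lt_one p (mem_nonleading.1 hw)).le)) (aCoef_nonneg lam u p w k)
  rw [epsC, Finset.sum_comm]
  gcongr with p hp
  refine le_trans (le_of_eq ?_) (Finset.single_le_sum (fun q _ => hterm q p hp)
    (Finset.mem_univ p))
  have hnu : nuPlus u p p = 1 := by
    rw [← h.sum_sq p, nuPlus]
    exact Finset.sum_congr rfl fun d _ => by rw [if_pos (mul_self_nonneg _), sq]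
  rw [aCoef, if_neg (not_lt.2 (mul_self_nonneg _)), if_pos (mul_self_nonneg _), hnu,
    abs_of_nonneg (mul_self_nonneg _)]
  ring

theorem le_sum_pow_mul_of_injective (h : IsConsensusSpectrum P lam u) {p : Fin M}
    (hp : (p : ℕ) ≠ 0) {n : ℕ} (k : Fin M) {t : Fin M → ℕ} (ht : Function.Injective t)
    (htn : ∀ j, t j < n) :
    -(1 / (4 * M) + M * (lam p ^ 2 / (1 - lam p ^ 2) * u p k ^ 2)) ≤
      ∑ j, lam p ^ (n - t j) * (u p k * u p j) := by
  have hM : (0 : ℝ) < M := by exact_mod_cast k.pos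
  have amgm : ∀ j, -(u p j ^ 2 / (4 * M) + M * ((lam p ^ 2) ^ (n - t j) * u p k ^ 2)) ≤
      lam p ^ (n - t j) * (u p k * u p j) := by
    intro j
    have hsq : 0 ≤ (u p j / (2 * M) + lam p ^ (n - t j) * u p k) ^ 2 * M := by positivity
    have hexpand : (u p j / (2 * M) + lam p ^ (n - t j) * u p k) ^ 2 * M
        = u p j ^ 2 / (4 * M) + M * ((lam p ^ 2) ^ (n - t j) * u p k ^ 2)
          + lam p ^ (n - t j) * (u p k * u p j) := by
      rw [pow_right_comm]
      field_simp
      ring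
    linarith
  refine le_trans ?_ (Finset.sum_le_sum fun j _ => amgm j)
  rw [Finset.sum_neg_distrib, Finset.sum_add_distrib, ← Finset.sum_div, h.sum_sq,
    ← Finset.mul_sum, ← Finset.sum_mul]
  gcongr
  exact sum_pow_sub_le_of_injective (sq_nonneg _)
    ((sq_lt_one_iff_abs_lt_one _).2 (h.abs_lt_one p hp)) ht htn

theorem le_sum_pow_apply_of_injective (h : IsConsensusSpectrum P lam u) {n : ℕ} (k : Fin M)
    {t : Fin M → ℕ} (ht : Function.Injective t) (htn : ∀ j, t j < n) :
    3 / 4 - epsC lam u k ≤ ∑ j, (P ^ (n - t j)) k j := by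
  have hM : (0 : ℝ) < M := by exact_mod_cast k.pos
  have htail := Finset.sum_le_sum fun p (hp : p ∈ nonleading M) =>
    h.le_sum_pow_mul_of_injective (mem_nonleading.1 hp) k ht htn
  rw [Finset.sum_neg_distrib, Finset.sum_add_distrib, ← Finset.mul_sum] at htail
  have hcard : ∑ _p ∈ nonleading M, 1 / (4 * (M : ℝ)) ≤ 1 / 4 := by
    calc ∑ _p ∈ nonleading M, 1 / (4 * (M : ℝ)) ≤ ∑ _p : Fin M, 1 / (4 * (M : ℝ)) :=
          Finset.sum_le_univ_sum_of_nonneg fun _ => by positivity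
      _ = 1 / 4 := by simp [field]
  have hsplit : ∑ j, (P ^ (n - t j)) k j
      = 1 + ∑ p ∈ nonleading M, ∑ j, lam p ^ (n - t j) * (u p k * u p j) := by
    simp only [h.pow_apply_eq_inv_add]
    rw [Finset.sum_add_distrib, Finset.sum_comm]
    simp [hM.ne']
  linarith [h.le_epsC k]

theorem le_runningConsensus_of_injective (h : IsConsensusSpectrum P lam u)
    (hξ : ∀ τ j, 0 ≤ ξ τ j) {n : ℕ} (k : Fin M) {t : Fin M → ℕ} (ht : Function.Injective t)
    (htn : ∀ j, t j < n) (htξ : ∀ j, ξ (t j) j = 1) :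
    3 / 4 - epsC lam u k ≤ runningConsensus P ξ n k := by
  refine (h.le_sum_pow_apply_of_injective k ht htn).trans ?_
  rw [runningConsensus, Finset.sum_comm]
  refine Finset.sum_le_sum fun j _ => ?_
  calc (P ^ (n - t j)) k j = (P ^ (n - t j)) k j * ξ (t j) j := by rw [htξ, mul_one]
    _ ≤ _ := Finset.single_le_sum (f := fun τ => (P ^ (n - τ)) k j * ξ τ j)
      (fun τ _ => mul_nonneg (h.pow_nonneg _ _ _) (hξ τ j)) (Finset.mem_range.2 (htn j))

end IsConsensusSpectrum

end RunningConsensus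

/-! ### Two convergent series -/

section Series

theorem sum_Ico_le_sub_of_hasDerivAt {F g : ℝ → ℝ} {a n : ℕ} (hn : a ≤ n)
    (hF : ∀ x : ℝ, a ≤ x → HasDerivAt F (g x) x) (hg : AntitoneOn g (Set.Ici (a : ℝ))) :
    ∑ s ∈ Finset.Ico (a + 1) (n + 1), g s ≤ F n - F a := by
  have hna : (a : ℝ) ≤ n := by exact_mod_cast hn
  have hgI : AntitoneOn g (Set.Icc (a : ℝ) n) := hg.mono Set.Icc_subset_Ici_self
  calc ∑ s ∈ Finset.Ico (a + 1) (n + 1), g s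
      = ∑ s ∈ Finset.Ico a n, g ((s + 1 : ℕ) : ℝ) :=
        (Finset.sum_Ico_add' (fun s : ℕ => g s) a n 1).symm
    _ ≤ ∫ x in (a : ℝ)..n, g x := hgI.sum_le_integral_Ico hn
    _ = F n - F a := by
        refine intervalIntegral.integral_eq_sub_of_hasDerivAt (fun x hx => hF x ?_)
          (AntitoneOn.intervalIntegrable (by rwa [Set.uIcc_of_le hna]))
        rw [Set.uIcc_of_le hna] at hx
        exact hx.1

theorem sum_one_div_rpow_le {γ : ℝ} (hγ : 1 < γ) (T : ℕ) :
    ∑ s ∈ Finset.Ico 2 T, 1 / (s : ℝ) ^ γ ≤ 1 / (γ - 1) := by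
  have hγ' : 0 < γ - 1 := by linarith
  rcases Nat.lt_or_ge T 2 with hT | hT
  · simpa [Finset.Ico_eq_empty_of_le hT.le] using hγ'.le
  obtain ⟨n, rfl⟩ : ∃ n, T = n + 1 := ⟨T - 1, by omega⟩
  have hsum_le := sum_Ico_le_sub_of_hasDerivAt (F := fun x => -(1 / (γ - 1)) * x ^ (1 - γ))
    (g := fun x => 1 / x ^ γ) (a := 1) (n := n) (by omega) ?_ ?_
  · simp only [Nat.cast_one, Real.one_rpow, mul_one, sub_neg_eq_add] at hsum_le
    have : 0 ≤ 1 / (γ - 1) * (n : ℝ) ^ (1 - γ) := by positivity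
    exact hsum_le.trans (by linarith)
  · intro x hx
    have hx0 : 0 < x := one_pos.trans_le (by simpa using hx)
    have hderiv := (Real.hasDerivAt_rpow_const (x := x) (p := 1 - γ) (Or.inl hx0.ne')).const_mul
      (-(1 / (γ - 1)))
    convert! hderiv using 1
    rw [show 1 - γ - 1 = -γ by ring, Real.rpow_neg hx0.le]
    field_simp
    ring
  · intro x hx y _ hxy
    have hx0 : 0 < x := one_pos.trans_le (by simpa using hx)
    simp only
    gcongr

theorem log_div_rpow_le_half {x γ : ℝ} (hx : 1 ≤ x) (hγ : 1 ≤ γ) :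
    Real.log x / x ^ γ ≤ 1 / 2 := by
  have hx0 : 0 < x := by linarith
  have hlog : Real.log x ≤ x / 2 := by
    have hhalf := Real.log_le_sub_one_of_pos (half_pos hx0)
    rw [Real.log_div hx0.ne' two_ne_zero] at hhalf
    linarith [Real.log_two_lt_d9]
  rw [div_le_div_iff₀ (by positivity) two_pos]
  linarith [Real.self_le_rpow_of_one_le hx hγ]

theorem hasDerivAt_log_div_rpow {γ x : ℝ} (hγ : 1 < γ) (hx : 0 < x) :
    HasDerivAt (fun x => -((Real.log x / (γ - 1) + 1 / (γ - 1) ^ 2) * x ^ (1 - γ)))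
      (Real.log x / x ^ γ) x := by
  have hγ' : γ - 1 ≠ 0 := by linarith
  have hderiv := ((((Real.hasDerivAt_log hx.ne').div_const (γ - 1)).add_const
    (1 / (γ - 1) ^ 2)).mul
    (Real.hasDerivAt_rpow_const (x := x) (p := 1 - γ) (Or.inl hx.ne'))).neg
  convert! hderiv using 1
  rw [show 1 - γ - 1 = -γ by ring, show 1 - γ = -γ + 1 by ring, Real.rpow_add hx,
    Real.rpow_neg hx.le, Real.rpow_one]
  field_simp
  ring

theorem log_div_add_mul_rpow_le {γ x : ℝ} (hγ : 1 < γ) (hx : 0 < x) :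
    (Real.log x / (γ - 1) + 1 / (γ - 1) ^ 2) * x ^ (1 - γ) ≤ 1 / (γ - 1) ^ 2 := by
  have hγ' : 0 < γ - 1 := by linarith
  have hrpow : x ^ (1 - γ) = (Real.exp (Real.log x * (γ - 1)))⁻¹ := by
    rw [Real.rpow_def_of_pos hx, ← Real.exp_neg]
    congr 1
    ring
  rw [hrpow, ← div_eq_mul_inv, div_le_iff₀ (Real.exp_pos _)]
  calc Real.log x / (γ - 1) + 1 / (γ - 1) ^ 2
      = 1 / (γ - 1) ^ 2 * (Real.log x * (γ - 1) + 1) := by field_simp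
    _ ≤ _ := by gcongr; exact Real.add_one_le_exp _

/- `log x / x ^ γ` decreases only from `exp (1 / γ)` on, so the integral test starts at `3` and the
terms `s = 2, 3` are bounded by `1 / 2` each. -/
theorem sum_log_div_rpow_le {γ : ℝ} (hγ : 1 < γ) (T : ℕ) :
    ∑ s ∈ Finset.Ico 2 T, Real.log s / (s : ℝ) ^ γ ≤ 1 / (γ - 1) ^ 2 + 1 := by
  obtain ⟨n, hTn, hn⟩ : ∃ n, T ≤ n + 1 ∧ 3 ≤ n := ⟨T + 3, by omega, by omega⟩
  have hhead : ∑ s ∈ Finset.Ico (2 : ℕ) 4, Real.log s / (s : ℝ) ^ γ ≤ 1 := by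
    calc ∑ s ∈ Finset.Ico (2 : ℕ) 4, Real.log s / (s : ℝ) ^ γ
        ≤ ∑ _s ∈ Finset.Ico (2 : ℕ) 4, (1 / 2 : ℝ) := Finset.sum_le_sum fun s hs =>
          log_div_rpow_le_half (by
            exact_mod_cast one_le_two.trans (Finset.mem_Ico.1 hs).1) hγ.le
      _ = 1 := by simp
  have hanti : AntitoneOn (fun x => Real.log x / x ^ γ) (Set.Ici ((3 : ℕ) : ℝ)) := by
    refine (Real.log_div_self_rpow_antitoneOn (by linarith)).mono (Set.Ici_subset_Ici.2 ?_)
    have hexp : Real.exp γ⁻¹ ≤ Real.exp 1 := Real.exp_le_exp.2 (inv_le_one_of_one_le₀ hγ.le)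
    push_cast
    linarith [Real.exp_one_lt_d9]
  have htail := sum_Ico_le_sub_of_hasDerivAt hn (fun x hx => hasDerivAt_log_div_rpow hγ
    (lt_of_lt_of_le (by norm_num) hx)) hanti
  have hlast : 0 ≤ (Real.log n / (γ - 1) + 1 / (γ - 1) ^ 2) * (n : ℝ) ^ (1 - γ) := by
    have : 0 < γ - 1 := by linarith
    have := Real.log_natCast_nonneg n
    positivity
  have hfirst := log_div_add_mul_rpow_le hγ (x := ((3 : ℕ) : ℝ)) (by norm_num)
  calc ∑ s ∈ Finset.Ico 2 T, Real.log s / (s : ℝ) ^ γ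
      ≤ ∑ s ∈ Finset.Ico 2 (n + 1), Real.log s / (s : ℝ) ^ γ :=
        Finset.sum_le_sum_of_subset_of_nonneg (Finset.Ico_subset_Ico_right hTn) fun s _ _ =>
          div_nonneg (Real.log_natCast_nonneg s) (by positivity)
    _ = ∑ s ∈ Finset.Ico (2 : ℕ) 4, Real.log s / (s : ℝ) ^ γ +
          ∑ s ∈ Finset.Ico 4 (n + 1), Real.log s / (s : ℝ) ^ γ :=
        (Finset.sum_Ico_consecutive _ (by norm_num) (by omega)).symm
    _ ≤ 1 / (γ - 1) ^ 2 + 1 := by linarith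

theorem sum_peeling_le {γ η : ℝ} (hγ : 1 < γ) (hη : 0 < η) {N : ℕ} (hN : 2 ≤ N) (T : ℕ) :
    ∑ s ∈ Finset.Ico N T, (2 * Real.log s / Real.log (1 + η) + 1) * (1 / (s : ℝ) ^ γ) ≤
      2 / Real.log (1 + η) * (1 / (γ - 1) ^ 2 + γ * Real.log (1 + η) / (γ - 1) + 1) := by
  have hγ' : 0 < γ - 1 := by linarith
  have hlog : 0 < Real.log (1 + η) := Real.log_pos (by linarith)
  calc ∑ s ∈ Finset.Ico N T, (2 * Real.log s / Real.log (1 + η) + 1) * (1 / (s : ℝ) ^ γ)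
      ≤ ∑ s ∈ Finset.Ico 2 T, (2 * Real.log s / Real.log (1 + η) + 1) * (1 / (s : ℝ) ^ γ) := by
        refine Finset.sum_le_sum_of_subset_of_nonneg (Finset.Ico_subset_Ico_left hN)
          fun s _ _ => ?_
        have := Real.log_natCast_nonneg s
        positivity
    _ = 2 / Real.log (1 + η) * ∑ s ∈ Finset.Ico 2 T, Real.log s / (s : ℝ) ^ γ
          + ∑ s ∈ Finset.Ico 2 T, 1 / (s : ℝ) ^ γ := by
        rw [Finset.mul_sum, ← Finset.sum_add_distrib]
        exact Finset.sum_congr rfl fun s _ => by ring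
    _ ≤ 2 / Real.log (1 + η) * (1 / (γ - 1) ^ 2 + 1) + 2 * γ * (1 / (γ - 1)) := by
        gcongr
        · exact sum_log_div_rpow_le hγ T
        · exact (sum_one_div_rpow_le hγ T).trans
            (le_mul_of_one_le_left (by positivity) (by linarith))
    _ = _ := by field_simp; ring

end Series

/-! ### The width of the confidence intervals -/

section Width

/-- The number of selections of an arm, over all agents, after which its confidence intervals have
half-width at most `Δ / 2`, when `F` and `L` are the current values of `f` and of the logarithm of
time. It is the part of `boundB` that depends on `T`. -/
noncomputable def explorationThreshold (M : ℕ) (σ γ η Δ F L : ℝ) : ℝ :=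
  4 * σ ^ 2 * γ / (Δ ^ 2 * gEta η) *
    (1 + √(1 + Δ ^ 2 * M * gEta η / (2 * σ ^ 2 * γ) * (F / L))) * L

theorem gEta_pos {η : ℝ} (hη : η ∈ Set.Ioo 0 4) : 0 < gEta η := by
  rw [gEta]
  nlinarith [hη.1, hη.2]

theorem explorationThreshold_nonneg (M : ℕ) {σ γ η Δ F L : ℝ} (hγ : 0 ≤ γ) (hη : 0 ≤ gEta η)
    (hL : 0 ≤ L) : 0 ≤ explorationThreshold M σ γ η Δ F L := by
  rw [explorationThreshold]
  positivity

theorem explorationThreshold_pos (M : ℕ) {σ γ η Δ F L : ℝ} (hσ : 0 < σ) (hγ : 0 < γ)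
    (hη : 0 < gEta η) (hΔ : 0 < Δ) (hL : 0 < L) : 0 < explorationThreshold M σ γ η Δ F L := by
  rw [explorationThreshold]
  positivity

theorem mul_add_le_sq_of_le {c F x : ℝ} (hc : 0 < c) (hx : c * (1 + √(1 + 4 * F / c)) ≤ 2 * x) :
    c * (x + F) ≤ x ^ 2 := by
  have hsqrt : √(1 + 4 * F / c) ≤ 2 * x / c - 1 := by
    rw [le_sub_iff_add_le', le_div_iff₀ hc]
    linarith
  have hsq : 1 + 4 * F / c ≤ (2 * x / c - 1) ^ 2 :=
    (Real.sqrt_le_left ((Real.sqrt_nonneg _).trans hsqrt)).1 hsqrt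
  have hdiff : (2 * x / c - 1) ^ 2 - (1 + 4 * F / c) = 4 / c ^ 2 * (x ^ 2 - c * (x + F)) := by
    field_simp
    ring
  have hpos : 0 ≤ 4 / c ^ 2 * (x ^ 2 - c * (x + F)) := by linarith
  linarith [(mul_nonneg_iff_of_pos_left (by positivity : (0 : ℝ) < 4 / c ^ 2)).1 hpos]

theorem mul_add_le_sq_of_explorationThreshold_le {M : ℕ} (hM : 0 < M) {σ γ η Δ F L x : ℝ}
    (hσ : 0 < σ) (hγ : 0 < γ) (hη : 0 < gEta η) (hΔ : 0 < Δ) (hL : 0 < L)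
    (hx : explorationThreshold M σ γ η Δ F L ≤ M * x) :
    8 * σ ^ 2 * γ * L / (M * gEta η * Δ ^ 2) * (x + F) ≤ x ^ 2 := by
  have hM' : (0 : ℝ) < M := by exact_mod_cast hM
  set c : ℝ := 8 * σ ^ 2 * γ * L / (M * gEta η * Δ ^ 2) with hc
  have hc0 : 0 < c := by positivity
  refine mul_add_le_sq_of_le hc0 ?_
  have hroot : Δ ^ 2 * M * gEta η / (2 * σ ^ 2 * γ) * (F / L) = 4 * F / c := by
    rw [hc]; field_simp; ring
  have hcoef : 4 * σ ^ 2 * γ / (Δ ^ 2 * gEta η) * L = M * (c / 2) := by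
    rw [hc]; field_simp; ring
  rw [explorationThreshold, hroot, mul_right_comm, hcoef, mul_assoc,
    mul_le_mul_iff_right₀ hM'] at hx
  linarith

theorem confWidth_le {M : ℕ} (hM : 0 < M) {σ γ η Δ F L x : ℝ} {f : ℝ → ℝ} {n : ℕ} (hσ : 0 < σ)
    (hγ : 0 < γ) (hη : 0 < gEta η) (hΔ : 0 < Δ) (hL : 0 < L) (hnL : Real.log n ≤ L)
    (hf0 : 0 ≤ f n) (hf : f n ≤ F) (hx0 : 0 < x)
    (hx : explorationThreshold M σ γ η Δ F L ≤ M * x) :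
    confWidth M σ γ η f n x ≤ Δ / 2 := by
  have : (0 : ℝ) < M := by exact_mod_cast hM
  have hF : 0 ≤ F := hf0.trans hf
  have hquad := mul_add_le_sq_of_explorationThreshold_le hM hσ hγ hη hΔ hL hx
  have hradicand :
      2 * γ / gEta η * ((x + f n) / (M * x)) * (Real.log n / x) ≤ (Δ / (2 * σ)) ^ 2 := by
    calc 2 * γ / gEta η * ((x + f n) / (M * x)) * (Real.log n / x)
        ≤ 2 * γ / gEta η * ((x + F) / (M * x)) * (L / x) := by gcongr
      _ = (Δ / (2 * σ)) ^ 2 *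
            (8 * σ ^ 2 * γ * L / (M * gEta η * Δ ^ 2) * (x + F) / x ^ 2) := by
          field_simp; ring
      _ ≤ (Δ / (2 * σ)) ^ 2 * 1 := by
          gcongr
          exact (div_le_one (by positivity)).2 hquad
      _ = _ := mul_one _
  calc confWidth M σ γ η f n x ≤ σ * √((Δ / (2 * σ)) ^ 2) := by rw [confWidth]; gcongr
    _ = Δ / 2 := by rw [Real.sqrt_sq (by positivity)]; field_simp

theorem confWidth_mul {M : ℕ} {σ γ η : ℝ} {f : ℝ → ℝ} {n : ℕ} {x : ℝ} (hx : 0 < x) :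
    confWidth M σ γ η f n x * x = σ * √(2 * (γ * Real.log n) / gEta η * ((x + f n) / M)) := by
  rw [confWidth, mul_assoc]
  congr 1
  rw [show ∀ y : ℝ, y * x = y * √(x ^ 2) by simp [Real.sqrt_sq hx.le],
    ← Real.sqrt_mul' _ (sq_nonneg x)]
  congr 1
  field_simp

theorem minGap_le {N : ℕ} (m : Fin N → ℝ) {i j : Fin N} (hij : i ≠ j) :
    minGap m ≤ |m i - m j| :=
  ciInf_le (Set.finite_range _).bddBelow (⟨(i, j), hij⟩ : {q : Fin N × Fin N // q.1 ≠ q.2})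

theorem minGap_pos {N : ℕ} (hN : 2 ≤ N) {m : Fin N → ℝ} (hm : Function.Injective m) :
    0 < minGap m := by
  have : Nonempty {q : Fin N × Fin N // q.1 ≠ q.2} :=
    ⟨⟨(⟨0, by omega⟩, ⟨1, by omega⟩), by simp⟩⟩
  obtain ⟨q, hq⟩ := exists_eq_ciInf_of_finite
    (f := fun q : {q : Fin N × Fin N // q.1 ≠ q.2} => |m q.1.1 - m q.1.2|)
  rw [minGap, ← hq]
  exact abs_pos.2 (sub_ne_zero.2 (hm.ne q.2))

end Width

/-! ### Exponential moments of the rewards -/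

section Concentration

variable {Ω : Type*} {N M : ℕ} {r : ℕ → Fin N → Fin M → Ω → ℝ} {sel : ℕ → Fin M → Ω → Fin N}

/-- The sigma-algebra of the rewards of a (round, agent) pair. The pairs are ordered
lexicographically, so that the rewards of the earlier rounds belong to smaller pairs. -/
abbrev rewardSigma (r : ℕ → Fin N → Fin M → Ω → ℝ) (q : ℕ ×ₗ Fin M) : MeasurableSpace Ω :=
  MeasurableSpace.comap (fun ω i => r (ofLex q).1 i (ofLex q).2 ω) inferInstance

theorem measurable_rewardSigma (n : ℕ) (i : Fin N) (k : Fin M) :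
    Measurable[rewardSigma r (toLex (n, k))] (r n i k) :=
  (measurable_pi_apply i).comp (comap_measurable fun ω i => r n i k ω)

theorem pastRewards_le_iSup_lt (n : ℕ) (k : Fin M) :
    pastRewards r n ≤ ⨆ q < toLex (n, k), rewardSigma r q :=
  iSup₂_le fun s hs => iSup₂_le fun i j => (measurable_rewardSigma s i j).comap_le.trans
    (le_iSup₂_of_le (toLex (s, j)) (Prod.Lex.toLex_lt_toLex.2 (Or.inl hs)) le_rfl)

variable [mΩ : MeasurableSpace Ω] {μ : Measure Ω}

theorem lintegral_ite_mul_le {mS mq : MeasurableSpace Ω} (hS : mS ≤ mΩ) (hq : mq ≤ mΩ)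
    (hind : Indep mS mq μ) {A : Ω → ENNReal} (hA : Measurable[mS] A) {E : Ω → Prop}
    [DecidablePred E] (hE : MeasurableSet[mS] {ω | E ω}) {H : Ω → ENNReal}
    (hH : Measurable[mq] H) (hH1 : ∫⁻ ω, H ω ∂μ ≤ 1) :
    ∫⁻ ω, (if E ω then H ω else 1) * A ω ∂μ ≤ ∫⁻ ω, A ω ∂μ := by
  have hAE : Measurable[mS] ({ω | E ω}.indicator A) := hA.indicator hE
  calc ∫⁻ ω, (if E ω then H ω else 1) * A ω ∂μ
      = ∫⁻ ω, ({ω | E ω}.indicator A ω * H ω + {ω | E ω}ᶜ.indicator A ω) ∂μ := by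
        refine lintegral_congr fun ω => ?_
        by_cases h : E ω <;> simp [h, mul_comm]
    _ = (∫⁻ ω, {ω | E ω}.indicator A ω ∂μ) * ∫⁻ ω, H ω ∂μ
          + ∫⁻ ω, {ω | E ω}ᶜ.indicator A ω ∂μ := by
        rw [lintegral_add_left (f := fun ω => {ω | E ω}.indicator A ω * H ω)
            ((hAE.mono hS le_rfl).mul (hH.mono hq le_rfl)),
          lintegral_mul_eq_lintegral_mul_lintegral_of_independent_measurableSpace hS hq hind hAE hH]
    _ ≤ (∫⁻ ω, {ω | E ω}.indicator A ω ∂μ) * 1 + ∫⁻ ω, {ω | E ω}ᶜ.indicator A ω ∂μ := by gcongr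
    _ = ∫⁻ ω, A ω ∂μ := by
        rw [mul_one, ← lintegral_add_left (hAE.mono hS le_rfl)]
        refine lintegral_congr fun ω => ?_
        by_cases h : E ω <;> simp [h]

theorem indep_iSup_lt {ι : Type*} [Preorder ι] {m : ι → MeasurableSpace Ω} (hm : ∀ i, m i ≤ mΩ)
    (hind : iIndep m μ) (a : ι) : Indep (⨆ i < a, m i) (m a) μ := by
  simpa using indep_iSup_of_disjoint hm hind (S := Set.Iio a) (T := {a}) (by simp)

/- Removing the factor of the largest index of `s`, which is independent of all the others, does not
decrease the integral. -/
theorem lintegral_prod_ite_le_one {ι : Type*} [LinearOrder ι] [IsProbabilityMeasure μ]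
    {m : ι → MeasurableSpace Ω} (hm : ∀ i, m i ≤ mΩ) (hind : iIndep m μ) {E : ι → Ω → Prop}
    [∀ i, DecidablePred (E i)] (hE : ∀ i, MeasurableSet[⨆ j < i, m j] {ω | E i ω})
    {H : ι → Ω → ENNReal} (hH : ∀ i, Measurable[m i] (H i)) (hH1 : ∀ i, ∫⁻ ω, H i ω ∂μ ≤ 1)
    (s : Finset ι) : ∫⁻ ω, ∏ i ∈ s, (if E i ω then H i ω else 1) ∂μ ≤ 1 := by
  induction s using Finset.induction_on_max with
  | empty => simp
  | insert a s hs ih =>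
    have hle : ∀ i ∈ s, ⨆ j < i, m j ≤ ⨆ j < a, m j := fun i hi =>
      biSup_mono fun j hj => hj.trans (hs i hi)
    have hmeas : Measurable[⨆ j < a, m j] fun ω => ∏ i ∈ s, if E i ω then H i ω else 1 :=
      Finset.measurable_fun_prod s fun i hi => Measurable.ite
        (hle i hi _ (hE i))
        ((hH i).mono (le_iSup₂_of_le i (hs i hi) le_rfl) le_rfl) measurable_const
    simp only [Finset.prod_insert fun ha => (hs a ha).false]
    exact (lintegral_ite_mul_le (iSup₂_le fun i _ => hm i) (hm a) (indep_iSup_lt hm hind a)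
      hmeas (hE a) (hH a) (hH1 a)).trans ih

theorem IsSubGaussianLaw.integrable {p : Measure ℝ} {σ : ℝ} (h : IsSubGaussianLaw p σ) :
    Integrable (fun x => x) p := by
  have huniv : integrableExpSet id p = Set.univ := by
    ext β
    simpa [integrableExpSet] using (h β).1
  simpa using integrable_pow_of_mem_interior_integrableExpSet (X := id) (μ := p) (by simp [huniv]) 1

theorem IsSubGaussianLaw.lintegral_exp_le {p : Measure ℝ} [IsProbabilityMeasure p] {σ : ℝ}
    (h : IsSubGaussianLaw p σ) (β : ℝ) :
    ∫⁻ x, ENNReal.ofReal (Real.exp (β * (x - ∫ y, y ∂p) - σ ^ 2 * β ^ 2 / 2)) ∂p ≤ 1 := by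
  set c : ℝ := (∫ y, y ∂p) * β + σ ^ 2 * β ^ 2 / 2 with hc
  have hmgf : ∫ x, Real.exp (β * x) ∂p ≤ Real.exp c :=
    (Real.log_le_iff_le_exp (mgf_pos (X := id) (h β).1)).1 (h β).2
  have hfactor : ∀ x, Real.exp (β * (x - ∫ y, y ∂p) - σ ^ 2 * β ^ 2 / 2)
      = Real.exp (-c) * Real.exp (β * x) := by
    intro x
    rw [← Real.exp_add, hc]
    congr 1
    ring
  simp only [hfactor]
  rw [← ofReal_integral_eq_lintegral_ofReal ((h β).1.const_mul _)
    (Filter.Eventually.of_forall fun x => by positivity), integral_const_mul,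
    ENNReal.ofReal_le_one, Real.exp_neg, inv_mul_le_iff₀ (Real.exp_pos _), mul_one]
  exact hmgf

variable {law : Fin N → Measure ℝ} {m : Fin N → ℝ} {σ : ℝ}

/-- The rewards `r n i k` are independent over the pairs `(n, k)`, and `r n i k` follows the
sub-Gaussian law `law i` of mean `m i`. -/
structure IsRewardModel (μ : Measure Ω) (law : Fin N → Measure ℝ) (m : Fin N → ℝ) (σ : ℝ)
    (r : ℕ → Fin N → Fin M → Ω → ℝ) : Prop where
  measurable : ∀ n i k, Measurable (r n i k)
  map_eq : ∀ n i k, μ.map (r n i k) = law i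
  mean_eq : ∀ i, m i = ∫ x, x ∂(law i)
  isSubGaussianLaw : ∀ i, IsSubGaussianLaw (law i) σ
  iIndepFun : iIndepFun (fun (q : ℕ × Fin M) ω i => r q.1 i q.2 ω) μ

theorem rewardSigma_le (hr : ∀ n i k, Measurable (r n i k)) (q : ℕ ×ₗ Fin M) :
    rewardSigma r q ≤ mΩ :=
  (measurable_pi_lambda _ fun i => hr _ i _).comap_le

theorem pastRewards_le (hr : ∀ n i k, Measurable (r n i k)) (n : ℕ) : pastRewards r n ≤ mΩ :=
  iSup₂_le fun s _ => iSup₂_le fun i k => (hr s i k).comap_le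

theorem DependsOnPast.measurable (hsel : DependsOnPast r sel) (hr : ∀ n i k, Measurable (r n i k))
    (n : ℕ) (k : Fin M) : Measurable (sel n k) :=
  (hsel n k).mono (pastRewards_le hr n) le_rfl

theorem IsRewardModel.iIndep_rewardSigma (hr : IsRewardModel μ law m σ r) :
    iIndep (rewardSigma r) μ :=
  (hr.iIndepFun.precomp ofLex.injective).iIndep

theorem IsRewardModel.isProbabilityMeasure_law [IsProbabilityMeasure μ]
    (hr : IsRewardModel μ law m σ r) (k : Fin M) (i : Fin N) : IsProbabilityMeasure (law i) :=
  hr.map_eq 0 i k ▸ Measure.isProbabilityMeasure_map (hr.measurable 0 i k).aemeasurable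

/- Every selection is decided before the reward that it reveals is drawn. -/
theorem IsRewardModel.lintegral_exp_sum_le [IsProbabilityMeasure μ]
    (hr : IsRewardModel μ law m σ r) (hsel : DependsOnPast r sel) (w : ℕ → Fin M → ℝ) (β : ℝ)
    (i : Fin N) (n : ℕ) :
    ∫⁻ ω, ENNReal.ofReal (Real.exp (∑ τ ∈ Finset.range n, ∑ j,
      (β * w τ j * (r τ i j ω - m i) - σ ^ 2 * (β * w τ j) ^ 2 / 2) *
        selInd (fun n k => sel n k ω) i τ j)) ∂μ ≤ 1 := by
  let h : ℕ ×ₗ Fin M → ℝ → ENNReal := fun q x => ENNReal.ofReal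
    (Real.exp (β * w (ofLex q).1 (ofLex q).2 * (x - m i)
      - σ ^ 2 * (β * w (ofLex q).1 (ofLex q).2) ^ 2 / 2))
  have hmeas : ∀ q, Measurable (h q) := fun q => by fun_prop
  have hmoment : ∀ q : ℕ ×ₗ Fin M,
      ∫⁻ ω, h q (r (ofLex q).1 i (ofLex q).2 ω) ∂μ ≤ 1 := by
    intro q
    have := hr.isProbabilityMeasure_law (ofLex q).2 i
    rw [← lintegral_map (hmeas q) (hr.measurable _ i _), hr.map_eq]
    simpa only [h, hr.mean_eq] using (hr.isSubGaussianLaw i).lintegral_exp_le _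
  refine le_of_eq_of_le (lintegral_congr fun ω => ?_) (lintegral_prod_ite_le_one
    (rewardSigma_le hr.measurable) hr.iIndep_rewardSigma
    (E := fun q ω => sel (ofLex q).1 (ofLex q).2 ω = i)
    (fun q => pastRewards_le_iSup_lt _ _ _ (hsel _ _ (measurableSet_singleton i)))
    (fun q => (hmeas q).comp (measurable_rewardSigma (ofLex q).1 i (ofLex q).2)) hmoment
    ((Finset.range n ×ˢ Finset.univ).map toLex.toEmbedding))
  rw [← Finset.sum_product', Real.exp_sum,
    ENNReal.ofReal_prod_of_nonneg fun _ _ => (Real.exp_pos _).le, Finset.prod_map]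
  refine Finset.prod_congr rfl fun q _ => ?_
  by_cases hq : sel q.1 q.2 ω = i <;> simp [h, selInd, hq]

end Concentration

/-! ### Peeling -/

section Peeling

/- With `c` midway between the square roots of the ends of the cell, `√y / c` stays within
`η / 4` of one, which is where `gEta` comes from. -/
theorem abs_one_sub_sqrt_div_le {η a y : ℝ} (hη : 0 < η) (ha : 0 < a) (hay : a ≤ y)
    (hya : y ≤ a * (1 + η)) : |1 - √y / ((1 + √(1 + η)) / 2 * √a)| ≤ η / 4 := by
  set q := √(1 + η)
  have hq1 : 1 < q := by rw [Real.lt_sqrt] <;> linarith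
  have hηq : η = (q - 1) * (q + 1) := by
    linarith [Real.sq_sqrt (show 0 ≤ 1 + η by linarith), show (q - 1) * (q + 1) = q ^ 2 - 1 by ring]
  have : 0 < √a := Real.sqrt_pos.2 ha
  have hlow : √a ≤ √y := Real.sqrt_le_sqrt hay
  have hup : √y ≤ √a * q := by
    rw [← Real.sqrt_mul ha.le]
    exact Real.sqrt_le_sqrt hya
  have hc0 : 0 < (1 + q) / 2 * √a := by positivity
  rw [one_sub_div hc0.ne', abs_div, abs_of_pos hc0, div_le_iff₀ hc0]
  calc |(1 + q) / 2 * √a - √y| ≤ (q - 1) / 2 * √a * 1 := by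
        rw [abs_le]
        constructor <;> linarith
    _ ≤ (q - 1) / 2 * √a * ((1 + q) ^ 2 / 4) := by
        have : 0 ≤ q - 1 := by linarith
        gcongr
        nlinarith
    _ = η / 4 * ((1 + q) / 2 * √a) := by rw [hηq]; ring

theorem exists_le_mul_sub_mul_sq {σ η ℓ a : ℝ} (hσ : 0 < σ) (hη : η ∈ Set.Ioo 0 4) (hℓ : 0 ≤ ℓ)
    (ha : 0 < a) :
    ∃ β, ∀ z v y, v ≤ y → a ≤ y → y ≤ a * (1 + η) → σ * √(2 * ℓ / gEta η * y) ≤ z →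
      ℓ ≤ β * z - β ^ 2 * σ ^ 2 / 2 * v := by
  have hG := gEta_pos hη
  have hη0 := hη.1
  set c : ℝ := (1 + √(1 + η)) / 2 * √a
  have hc0 : 0 < c := by positivity
  set d := √(2 * ℓ / gEta η) with hd
  have : 0 ≤ d := Real.sqrt_nonneg _
  refine ⟨d / (σ * c), fun z v y hvy hay hya hz => ?_⟩
  set x := √y / c with hx
  have hxη : (1 - x) ^ 2 ≤ (η / 4) ^ 2 := sq_le_sq' (by
    linarith [neg_le_of_abs_le (abs_one_sub_sqrt_div_le hη0 ha hay hya)])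
    (le_of_abs_le (abs_one_sub_sqrt_div_le hη0 ha hay hya))
  rw [Real.sqrt_mul (by positivity), ← hd] at hz
  calc ℓ = d ^ 2 * (gEta η / 2) := by rw [Real.sq_sqrt (by positivity)]; field_simp
    _ ≤ d ^ 2 * (x - x ^ 2 / 2) := by
        gcongr
        rw [gEta]
        linarith
    _ = d / (σ * c) * (σ * (d * √y)) - (d / (σ * c)) ^ 2 * σ ^ 2 / 2 * √y ^ 2 := by
        rw [hx]
        field_simp
    _ ≤ d / (σ * c) * z - (d / (σ * c)) ^ 2 * σ ^ 2 / 2 * v := by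
        rw [Real.sq_sqrt (ha.le.trans hay)]
        gcongr

variable {Ω : Type*} [MeasurableSpace Ω] {μ : Measure Ω}

theorem measure_le_exp_neg_of_lintegral_exp_le {X : Ω → ℝ} (hX : Measurable X)
    (hexp : ∫⁻ ω, ENNReal.ofReal (Real.exp (X ω)) ∂μ ≤ 1) (ℓ : ℝ) :
    μ {ω | ℓ ≤ X ω} ≤ ENNReal.ofReal (Real.exp (-ℓ)) := by
  have hsub : {ω | ℓ ≤ X ω} ⊆
      {ω | ENNReal.ofReal (Real.exp ℓ) ≤ ENNReal.ofReal (Real.exp (X ω))} :=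
    fun ω hω => ENNReal.ofReal_le_ofReal (Real.exp_le_exp.2 hω)
  refine (measure_mono hsub).trans ((meas_ge_le_lintegral_div
    (by fun_prop) (by simp [Real.exp_pos]) ENNReal.ofReal_ne_top).trans ?_)
  rw [Real.exp_neg, ENNReal.ofReal_inv_of_pos (Real.exp_pos _), ← one_div]
  gcongr

/- The range `[a, a * R]` of `Y` is cut into cells on which `Y` varies by a factor `1 + η`. -/
theorem measure_peeling_le {σ η ℓ a R : ℝ} (hσ : 0 < σ) (hη : η ∈ Set.Ioo 0 4) (hℓ : 0 ≤ ℓ)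
    (ha : 0 < a) (hR : 1 ≤ R) {Z V Y : Ω → ℝ} (hZ : Measurable Z) (hV : Measurable V)
    (hexp : ∀ β, ∫⁻ ω, ENNReal.ofReal (Real.exp (β * Z ω - β ^ 2 * σ ^ 2 / 2 * V ω)) ∂μ ≤ 1)
    {E : Set Ω} (hVE : ∀ ω ∈ E, V ω ≤ Y ω) (hYE : ∀ ω ∈ E, Y ω ∈ Set.Icc a (a * R))
    (hZE : ∀ ω ∈ E, σ * √(2 * ℓ / gEta η * Y ω) ≤ Z ω) :
    μ E ≤ ENNReal.ofReal ((Real.log R / Real.log (1 + η) + 1) * Real.exp (-ℓ)) := by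
  have hη1 : 1 < 1 + η := by linarith [hη.1]
  have hlog : 0 < Real.log (1 + η) := Real.log_pos hη1
  choose β hβ using fun j : ℕ => exists_le_mul_sub_mul_sq hσ hη hℓ
    (show 0 < a * (1 + η) ^ j by positivity)
  let cell : ℕ → Set Ω := fun j => {ω | ℓ ≤ β j * Z ω - β j ^ 2 * σ ^ 2 / 2 * V ω}
  let K := ⌊Real.log R / Real.log (1 + η)⌋₊ + 1
  have hcover : E ⊆ ⋃ j ∈ Finset.range K, cell j := by
    intro ω hω
    obtain ⟨haY, hYR⟩ := hYE ω hω
    obtain ⟨j, hj, hj'⟩ := exists_nat_pow_near ((one_le_div ha).2 haY) hη1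
    rw [le_div_iff₀' ha] at hj
    rw [div_lt_iff₀' ha, pow_succ, ← mul_assoc] at hj'
    have hjR : (j : ℝ) ≤ Real.log R / Real.log (1 + η) := by
      rw [le_div_iff₀ hlog, ← Real.log_pow]
      exact Real.log_le_log (by positivity) (le_of_mul_le_mul_left (hj.trans hYR) ha)
    exact Set.mem_biUnion (Finset.mem_range.2 (Nat.lt_succ_of_le (Nat.le_floor hjR)))
      (hβ j _ _ _ (hVE ω hω) hj hj'.le (hZE ω hω))
  calc μ E ≤ ∑ j ∈ Finset.range K, μ (cell j) :=
        (measure_mono hcover).trans (measure_biUnion_finset_le _ _)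
    _ ≤ ∑ _j ∈ Finset.range K, ENNReal.ofReal (Real.exp (-ℓ)) :=
        Finset.sum_le_sum fun j _ =>
          measure_le_exp_neg_of_lintegral_exp_le (by fun_prop) (hexp (β j)) ℓ
    _ = ENNReal.ofReal (K * Real.exp (-ℓ)) := by
        rw [Finset.sum_const, Finset.card_range, nsmul_eq_mul,
          ENNReal.ofReal_mul (Nat.cast_nonneg K), ENNReal.ofReal_natCast]
    _ ≤ _ := by
        gcongr
        push_cast [K]
        gcongr
        exact Nat.floor_le (div_nonneg (Real.log_nonneg hR) hlog.le)

end Peeling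

/-! ### Deviations of the estimates -/

section Tail

variable {N M : ℕ}

theorem exists_injective_init_eq {sel : ℕ → Fin M → Fin N} (hMN : M ≤ N)
    (hinit : ∀ n < N, ∀ k, (sel n k : ℕ) = (n + k) % N) (i : Fin N) :
    ∃ t : Fin M → ℕ, Function.Injective t ∧ (∀ j, t j < N) ∧ ∀ j, sel (t j) j = i := by
  have hround : ∀ j : Fin M, ∃ t < N, (t + j) % N = i := by
    intro j
    refine ⟨(i + (N - j)) % N, Nat.mod_lt _ i.pos, ?_⟩
    rw [Nat.mod_add_mod, add_assoc, Nat.sub_add_cancel (by omega), Nat.add_mod_right,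
      Nat.mod_eq_of_lt i.2]
  choose t ht hti using hround
  refine ⟨t, fun a c hac => ?_, ht, fun j => Fin.ext ((hinit _ (ht j) j).trans (hti j))⟩
  have hmod : t a + a ≡ t a + c [MOD N] := (hti a).trans (hac ▸ (hti c).symm)
  exact Fin.ext ((Nat.ModEq.add_left_cancel' _ hmod).eq_of_lt_of_lt (by omega) (by omega))

theorem sum_init_selInd_le {sel : ℕ → Fin M → Fin N}
    (hinit : ∀ n < N, ∀ k, (sel n k : ℕ) = (n + k) % N) (i : Fin N) :
    ∑ τ ∈ Finset.range N, ∑ j, selInd sel i τ j ≤ M := by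
  have hcard : ∀ j, ((Finset.range N).filter fun τ => sel τ j = i).card ≤ 1 := by
    refine fun j => Finset.card_le_one.2 fun a ha c hc => ?_
    simp only [Finset.mem_filter, Finset.mem_range] at ha hc
    have hmod : a + j ≡ c + j [MOD N] := by
      rw [Nat.ModEq, ← hinit a ha.1 j, ← hinit c hc.1 j, ha.2, hc.2]
    exact (Nat.ModEq.add_right_cancel' _ hmod).eq_of_lt_of_lt ha.1 hc.1
  rw [Finset.sum_comm]
  calc ∑ j, ∑ τ ∈ Finset.range N, selInd sel i τ j ≤ ∑ _j : Fin M, (1 : ℝ) := by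
        refine Finset.sum_le_sum fun j _ => ?_
        simp only [selInd, Finset.sum_boole]
        exact_mod_cast hcard j
    _ = M := by simp

/-- The sum of the squared weights with which the selections of arm `i` enter `nHat P sel i n k`;
up to the factor `σ ^ 2` it is the variance proxy of `ŝ - m n̂`. -/
noncomputable def sqWeight (P : Matrix (Fin M) (Fin M) ℝ) (sel : ℕ → Fin M → Fin N) (i : Fin N)
    (n : ℕ) (k : Fin M) : ℝ :=
  ∑ τ ∈ Finset.range n, ∑ j, (P ^ (n - τ)) k j ^ 2 * selInd sel i τ j

theorem sHat_sub_mul_nHat (P : Matrix (Fin M) (Fin M) ℝ) (r : ℕ → Fin N → Fin M → ℝ)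
    (sel : ℕ → Fin M → Fin N) (i : Fin N) (n : ℕ) (k : Fin M) (c : ℝ) :
    sHat P r sel i n k - c * nHat P sel i n k =
      runningConsensus P (fun τ j => (r τ i j - c) * selInd sel i τ j) n k := by
  simp only [sHat_eq_runningConsensus, nHat_eq_runningConsensus, runningConsensus, Finset.mul_sum,
    ← Finset.sum_sub_distrib]
  refine Finset.sum_congr rfl fun τ _ => Finset.sum_congr rfl fun j _ => ?_
  ring

variable {Ω : Type*} [MeasurableSpace Ω] {μ : Measure Ω} {P : Matrix (Fin M) (Fin M) ℝ}
  {r : ℕ → Fin N → Fin M → Ω → ℝ} {sel : ℕ → Fin M → Ω → Fin N}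

section Measurability

theorem DependsOnPast.measurable_selInd (hsel : DependsOnPast r sel)
    (hr : ∀ n i k, Measurable (r n i k)) (i : Fin N) (n : ℕ) (k : Fin M) :
    Measurable fun ω => selInd (sel · · ω) i n k :=
  Measurable.ite (hsel.measurable hr n k (measurableSet_singleton i)) measurable_const
    measurable_const

theorem DependsOnPast.measurable_nHat (hsel : DependsOnPast r sel)
    (hr : ∀ n i k, Measurable (r n i k)) (i : Fin N) (n : ℕ) (k : Fin M) :
    Measurable fun ω => nHat P (sel · · ω) i n k := by
  simp only [nHat_eq_runningConsensus, runningConsensus]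
  exact Finset.measurable_fun_sum _ fun τ _ => Finset.measurable_fun_sum _ fun j _ =>
    (hsel.measurable_selInd hr i τ j).const_mul _

theorem DependsOnPast.measurable_sHat (hsel : DependsOnPast r sel)
    (hr : ∀ n i k, Measurable (r n i k)) (i : Fin N) (n : ℕ) (k : Fin M) :
    Measurable fun ω => sHat P (r · · · ω) (sel · · ω) i n k := by
  simp only [sHat_eq_runningConsensus, runningConsensus]
  exact Finset.measurable_fun_sum _ fun τ _ => Finset.measurable_fun_sum _ fun j _ =>
    ((hr τ i j).mul (hsel.measurable_selInd hr i τ j)).const_mul _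

theorem DependsOnPast.measurable_sqWeight (hsel : DependsOnPast r sel)
    (hr : ∀ n i k, Measurable (r n i k)) (i : Fin N) (n : ℕ) (k : Fin M) :
    Measurable fun ω => sqWeight P (sel · · ω) i n k :=
  Finset.measurable_fun_sum _ fun τ _ => Finset.measurable_fun_sum _ fun j _ =>
    (hsel.measurable_selInd hr i τ j).const_mul _

end Measurability

theorem IsRewardModel.lintegral_exp_sHat_sub_le [IsProbabilityMeasure μ] {law : Fin N → Measure ℝ}
    {m : Fin N → ℝ} {σ : ℝ} (hr : IsRewardModel μ law m σ r) (hsel : DependsOnPast r sel)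
    (i : Fin N) (n : ℕ) (k : Fin M) (β : ℝ) :
    ∫⁻ ω, ENNReal.ofReal (Real.exp (
      β * (sHat P (r · · · ω) (sel · · ω) i n k - m i * nHat P (sel · · ω) i n k) -
        β ^ 2 * σ ^ 2 / 2 * sqWeight P (sel · · ω) i n k)) ∂μ ≤ 1 := by
  refine le_of_eq_of_le (lintegral_congr fun ω => ?_)
    (hr.lintegral_exp_sum_le hsel (fun τ j => (P ^ (n - τ)) k j) β i n)
  congr 2
  simp only [sHat_sub_mul_nHat, runningConsensus, sqWeight, Finset.mul_sum,
    ← Finset.sum_sub_distrib]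
  refine Finset.sum_congr rfl fun τ _ => Finset.sum_congr rfl fun j _ => ?_
  ring

/-- The event that the estimate of agent `k` of the mean of arm `i` errs by at least the confidence
width, upwards for `s = 1` and downwards for `s = -1`. -/
def deviation (P : Matrix (Fin M) (Fin M) ℝ) (σ γ η : ℝ) (f : ℝ → ℝ)
    (r : ℕ → Fin N → Fin M → Ω → ℝ) (sel : ℕ → Fin M → Ω → Fin N) (m : Fin N → ℝ) (n : ℕ)
    (k : Fin M) (i : Fin N) (s : ℝ) : Set Ω :=
  {ω | nHat P (sel · · ω) i n k ≠ 0 ∧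
    confWidth M σ γ η f n (nHat P (sel · · ω) i n k) ≤
      s * (sHat P (r · · · ω) (sel · · ω) i n k / nHat P (sel · · ω) i n k - m i)}

theorem measurableSet_deviation (hr : ∀ n i k, Measurable (r n i k)) (hsel : DependsOnPast r sel)
    (σ γ η : ℝ) (f : ℝ → ℝ) (m : Fin N → ℝ) (n : ℕ) (k : Fin M) (i : Fin N) (s : ℝ) :
    MeasurableSet (deviation P σ γ η f r sel m n k i s) := by
  have hn := hsel.measurable_nHat (P := P) hr i n k
  have herr := (((hsel.measurable_sHat (P := P) hr i n k).div hn).sub_const (m i)).const_mul s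
  refine (hn (measurableSet_singleton 0).compl).inter (measurableSet_le ?_ herr)
  unfold confWidth
  fun_prop

variable {lam : Fin M → ℝ} {u : Fin M → Fin M → ℝ}

theorem IsConsensusSpectrum.sqWeight_le (h : IsConsensusSpectrum P lam u)
    (sel : ℕ → Fin M → Fin N) (i : Fin N) (n : ℕ) {k : Fin M} {F : ℝ} (hF : epsC lam u k ≤ F) :
    sqWeight P sel i n k ≤ (nHat P sel i n k + F) / M := by
  rw [le_div_iff₀' (by exact_mod_cast k.pos), nHat_eq_runningConsensus]
  exact (h.mul_sum_sq_le_runningConsensus (selInd_mem_Icc sel i) n k).trans (by gcongr)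

theorem IsConsensusSpectrum.nHat_add_mem_Icc (h : IsConsensusSpectrum P lam u) (hMN : M ≤ N)
    {sel : ℕ → Fin M → Fin N} (hinit : ∀ n < N, ∀ k, (sel n k : ℕ) = (n + k) % N) {n : ℕ}
    (hN : 2 ≤ N) (hn : N ≤ n) (i : Fin N) {k : Fin M} {F : ℝ} (hF : epsC lam u k ≤ F) :
    nHat P sel i n k + F ∈ Set.Icc (max (3 / 4) F) (max (3 / 4) F * (n : ℝ) ^ 2) := by
  rw [nHat_eq_runningConsensus]
  have hn2 : (2 : ℝ) ≤ n := by exact_mod_cast hN.trans hn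
  have hmem := selInd_mem_Icc sel i
  obtain ⟨t, ht, htN, hti⟩ := exists_injective_init_eq hMN hinit i
  have hlow := h.le_runningConsensus_of_injective (fun τ j => (hmem τ j).1) k ht
    (fun j => (htN j).trans_le hn) (fun j => if_pos (hti j))
  have hnonneg := h.runningConsensus_nonneg (fun τ j => (hmem τ j).1) n k
  have hup := h.runningConsensus_le (fun τ j => (hmem τ j).2) n k
  refine ⟨max_le (by linarith) (by linarith), ?_⟩
  have hmax : 3 / 4 * ((n : ℝ) ^ 2 - 1) ≤ max (3 / 4) F * ((n : ℝ) ^ 2 - 1) := by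
    gcongr
    · nlinarith
    · exact le_max_left _ _
  nlinarith [le_max_right (3 / 4) F]

theorem measure_deviation_le [IsProbabilityMeasure μ] (h : IsConsensusSpectrum P lam u)
    (hN : 2 ≤ N) (hMN : M ≤ N) {σ γ η : ℝ} (hσ : 0 < σ) (hγ : 0 ≤ γ) (hη : η ∈ Set.Ioo 0 4)
    {f : ℝ → ℝ} {law : Fin N → Measure ℝ} {m : Fin N → ℝ} (hr : IsRewardModel μ law m σ r)
    (hsel : DependsOnPast r sel)
    (hinit : ∀ ω, ∀ n < N, ∀ k, (sel n k ω : ℕ) = (n + k) % N) {n : ℕ} (hn : N ≤ n)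
    {k : Fin M} (hf : epsC lam u k ≤ f n) (i : Fin N) {s : ℝ} (hs : s ^ 2 = 1) :
    μ (deviation P σ γ η f r sel m n k i s) ≤
      ENNReal.ofReal ((2 * Real.log n / Real.log (1 + η) + 1) * (1 / (n : ℝ) ^ γ)) := by
  have hM : (0 : ℝ) < M := by exact_mod_cast k.pos
  have hn1 : (1 : ℝ) ≤ n := by exact_mod_cast (show 1 ≤ n by omega)
  let x : Ω → ℝ := fun ω => nHat P (sel · · ω) i n k
  let z : Ω → ℝ := fun ω => sHat P (r · · · ω) (sel · · ω) i n k - m i * x ω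
  have hexp : ∀ β, ∫⁻ ω, ENNReal.ofReal (Real.exp (β * (s * z ω) -
      β ^ 2 * σ ^ 2 / 2 * sqWeight P (sel · · ω) i n k)) ∂μ ≤ 1 := by
    intro β
    simpa only [mul_pow, hs, mul_one, mul_assoc] using
      hr.lintegral_exp_sHat_sub_le (P := P) hsel i n k (β * s)
  have hpeel := measure_peeling_le hσ hη (ℓ := γ * Real.log n) (R := (n : ℝ) ^ 2)
    (a := max (3 / 4) (f n) / M) (E := deviation P σ γ η f r sel m n k i s)
    (Y := fun ω => (x ω + f n) / M) (Z := fun ω => s * z ω)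
    (mul_nonneg hγ (Real.log_natCast_nonneg n)) (by positivity) (one_le_pow₀ hn1)
    (((hsel.measurable_sHat hr.measurable i n k).sub
      ((hsel.measurable_nHat hr.measurable i n k).const_mul _)).const_mul s)
    (hsel.measurable_sqWeight hr.measurable i n k) hexp
    (fun ω _ => h.sqWeight_le (sel · · ω) i n hf) ?_ ?_
  · rwa [Real.log_pow, Nat.cast_ofNat, mul_comm γ, Real.exp_neg, ← Real.rpow_def_of_pos
      (by linarith), inv_eq_one_div] at hpeel
  · intro ω _
    obtain ⟨hlow, hup⟩ := h.nHat_add_mem_Icc hMN (hinit ω) hN hn i hf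
    rw [Set.mem_Icc, div_mul_eq_mul_div]
    exact ⟨by gcongr, by gcongr⟩
  · rintro ω ⟨hx0, hwidth⟩
    have hxpos : 0 < x ω := lt_of_le_of_ne (by
      simpa only [x, nHat_eq_runningConsensus] using h.runningConsensus_nonneg
        (fun τ j => (selInd_mem_Icc (sel · · ω) i τ j).1) n k) (Ne.symm hx0)
    calc σ * √(2 * (γ * Real.log n) / gEta η * ((x ω + f n) / M))
        = confWidth M σ γ η f n (x ω) * x ω := (confWidth_mul hxpos).symm
      _ ≤ s * (sHat P (r · · · ω) (sel · · ω) i n k / x ω - m i) * x ω := by gcongr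
      _ = s * z ω := by simp only [z]; field_simp

end Tail

/-! ### Wrong selections -/

section Selection

theorem le_of_ite_top_le {p q : Prop} [Decidable p] [Decidable q] {x y : ℝ} (hq : ¬q)
    (h : (if p then (⊤ : EReal) else (x : EReal)) ≤ if q then ⊤ else (y : EReal)) :
    ¬p ∧ x ≤ y := by
  rw [if_neg hq] at h
  split_ifs at h with hp
  · exact absurd (top_le_iff.1 h) (EReal.coe_ne_top y)
  · exact ⟨hp, EReal.coe_le_coe_iff.1 h⟩

theorem le_of_le_ite_bot {p q : Prop} [Decidable p] [Decidable q] {x y : ℝ} (hq : ¬q)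
    (h : (if q then (⊥ : EReal) else (y : EReal)) ≤ if p then ⊥ else (x : EReal)) :
    ¬p ∧ y ≤ x := by
  rw [if_neg hq] at h
  split_ifs at h with hp
  · exact absurd (le_bot_iff.1 h) (EReal.coe_ne_bot y)
  · exact ⟨hp, EReal.coe_le_coe_iff.1 h⟩

variable {N M : ℕ} {m : Fin N → ℝ} {b : Equiv.Perm (Fin N)} {c i : Fin N}

section Pigeonhole

variable {Q W : Fin N → EReal}

theorem IsSelectiveChoice.exists_upper_le (hb : Antitone fun j => m (b j))
    (hch : IsSelectiveChoice (c + 1) Q W i) (hi : m i < m (b c)) :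
    ∃ j, m (b c) ≤ m j ∧ Q j ≤ Q i := by
  obtain ⟨O, hcard, hO, hiO, -⟩ := hch
  suffices hout : ∃ j, m (b c) ≤ m j ∧ j ∉ O from
    hout.imp fun j hj => ⟨hj.1, hO i hiO j hj.2⟩
  by_contra! hall
  have hsub : (Finset.Iic c).map b.toEmbedding ⊆ O := by
    intro j hj
    obtain ⟨d, hd, rfl⟩ := Finset.mem_map.1 hj
    exact hall _ (hb (Finset.mem_Iic.1 hd))
  rw [← Finset.eq_of_subset_of_card_le hsub (by simp [hcard])] at hiO
  obtain ⟨d, hd, rfl⟩ := Finset.mem_map.1 hiO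
  exact hi.not_ge (hb (Finset.mem_Iic.1 hd))

theorem IsSelectiveChoice.exists_lower_le (hb : Antitone fun j => m (b j))
    (hch : IsSelectiveChoice (c + 1) Q W i) : ∃ j, m j ≤ m (b c) ∧ W i ≤ W j := by
  obtain ⟨O, hcard, -, -, hmin⟩ := hch
  suffices hin : ∃ j, m j ≤ m (b c) ∧ j ∈ O from hin.imp fun j hj => ⟨hj.1, hmin j hj.2⟩
  by_contra! hall
  have hsub : O ⊆ (Finset.Iio c).map b.toEmbedding := by
    intro j hj
    refine Finset.mem_map.2 ⟨b.symm j, Finset.mem_Iio.2 ?_, b.apply_symm_apply j⟩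
    by_contra! hcj
    exact hall j (by simpa using hb hcj) hj
  have hle := Finset.card_le_card hsub
  simp [hcard] at hle

end Pigeonhole

variable {Ω : Type*} {P : Matrix (Fin M) (Fin M) ℝ} {σ γ η : ℝ} {f : ℝ → ℝ}
  {r : ℕ → Fin N → Fin M → Ω → ℝ} {sel : ℕ → Fin M → Ω → Fin N}

open Classical in
/-- The estimation errors that can make agent `k`, whose target is the arm `a`, select arm `i`
though its confidence interval is short: arm `i` is misjudged in the direction of the mean of `a`,
or some arm in the opposite direction. -/
def errorEvent (P : Matrix (Fin M) (Fin M) ℝ) (σ γ η : ℝ) (f : ℝ → ℝ)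
    (r : ℕ → Fin N → Fin M → Ω → ℝ) (sel : ℕ → Fin M → Ω → Fin N) (m : Fin N → ℝ) (n : ℕ)
    (k : Fin M) (a i : Fin N) : Set Ω :=
  let s : ℝ := if m i < m a then 1 else -1
  deviation P σ γ η f r sel m n k i s ∪ ⋃ j, deviation P σ γ η f r sel m n k j (-s)

section Mem

variable {n : ℕ} {k : Fin M} {ω : Ω}

theorem mem_errorEvent_of_lt (hb : Antitone fun j => m (b j))
    (hch : IsSelectiveChoice (c + 1) (upperIndex P σ γ η f (r · · · ω) (sel · · ω) n k)
      (lowerIndex P σ γ η f (r · · · ω) (sel · · ω) n k) i)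
    (hx : nHat P (sel · · ω) i n k ≠ 0)
    (hC : confWidth M σ γ η f n (nHat P (sel · · ω) i n k) ≤ minGap m / 2)
    (hi : m i < m (b c)) : ω ∈ errorEvent P σ γ η f r sel m n k (b c) i := by
  obtain ⟨j, hj, hQ⟩ := hch.exists_upper_le hb hi
  obtain ⟨hxj, hle⟩ := le_of_ite_top_le hx hQ
  have hgap : minGap m ≤ m j - m i := by
    have := minGap_le m (i := j) (j := i) (by rintro rfl; linarith)
    rwa [abs_of_pos (by linarith)] at this
  rw [errorEvent, if_pos hi]
  by_contra hcon
  simp only [Set.mem_union, Set.mem_iUnion, not_or, not_exists, deviation, Set.mem_ofPred_eq,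
    not_and, not_le] at hcon
  linarith [hcon.1 hx, hcon.2 j hxj]

theorem mem_errorEvent_of_gt (hb : Antitone fun j => m (b j))
    (hch : IsSelectiveChoice (c + 1) (upperIndex P σ γ η f (r · · · ω) (sel · · ω) n k)
      (lowerIndex P σ γ η f (r · · · ω) (sel · · ω) n k) i)
    (hx : nHat P (sel · · ω) i n k ≠ 0)
    (hC : confWidth M σ γ η f n (nHat P (sel · · ω) i n k) ≤ minGap m / 2)
    (hi : m (b c) < m i) : ω ∈ errorEvent P σ γ η f r sel m n k (b c) i := by
  obtain ⟨j, hj, hW⟩ := hch.exists_lower_le hb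
  obtain ⟨hxj, hle⟩ := le_of_le_ite_bot hx hW
  have hgap : minGap m ≤ m i - m j := by
    have := minGap_le m (i := i) (j := j) (by rintro rfl; linarith)
    rwa [abs_of_pos (by linarith)] at this
  rw [errorEvent, if_neg hi.not_gt]
  by_contra hcon
  simp only [Set.mem_union, Set.mem_iUnion, not_or, not_exists, deviation, Set.mem_ofPred_eq,
    not_and, not_le] at hcon
  linarith [hcon.1 hx, hcon.2 j hxj]

end Mem

variable [MeasurableSpace Ω] {μ : Measure Ω}

theorem measurableSet_errorEvent (hr : ∀ n i k, Measurable (r n i k)) (hsel : DependsOnPast r sel)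
    (σ γ η : ℝ) (f : ℝ → ℝ) (m : Fin N → ℝ) (n : ℕ) (k : Fin M) (a i : Fin N) :
    MeasurableSet (errorEvent P σ γ η f r sel m n k a i) :=
  (measurableSet_deviation hr hsel σ γ η f m n k i _).union
    (MeasurableSet.iUnion fun j => measurableSet_deviation hr hsel σ γ η f m n k j _)

theorem measureReal_errorEvent_le {n : ℕ} {k : Fin M} {p : ℝ} (hp : 0 ≤ p)
    (hdev : ∀ (j : Fin N) (s : ℝ), s ^ 2 = 1 →
      μ (deviation P σ γ η f r sel m n k j s) ≤ ENNReal.ofReal p) (a i : Fin N) :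
    μ.real (errorEvent P σ γ η f r sel m n k a i) ≤ (N + 1) * p := by
  have hreal : ∀ (j : Fin N) (s : ℝ), s ^ 2 = 1 →
      μ.real (deviation P σ γ η f r sel m n k j s) ≤ p :=
    fun j s hs => ENNReal.toReal_le_of_le_ofReal hp (hdev j s hs)
  obtain ⟨s, hs, heq⟩ : ∃ s : ℝ, s ^ 2 = 1 ∧ errorEvent P σ γ η f r sel m n k a i =
      deviation P σ γ η f r sel m n k i s ∪ ⋃ j, deviation P σ γ η f r sel m n k j (-s) :=
    ⟨_, by split_ifs <;> norm_num, rfl⟩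
  calc μ.real (errorEvent P σ γ η f r sel m n k a i)
      ≤ μ.real (deviation P σ γ η f r sel m n k i s) +
          ∑ j, μ.real (deviation P σ γ η f r sel m n k j (-s)) := by
        rw [heq]
        exact (measureReal_union_le _ _).trans (by gcongr; exact measureReal_iUnion_fintype_le _)
    _ ≤ p + ∑ _j : Fin N, p := by
        gcongr with j
        · exact hreal i s hs
        · exact hreal j (-s) (by rwa [neg_sq])
    _ = (N + 1) * p := by simp; ring

end Selection

section WrongCount

theorem sum_ite_count_le {a : ℕ → ℝ} {N : ℕ} {K X : ℝ} (ha0 : ∀ n, 0 ≤ a n) (haK : ∀ n, a n ≤ K)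
    (hX : 0 ≤ X) (hinit : ∑ τ ∈ Finset.range N, a τ ≤ K) (T : ℕ) :
    ∑ n ∈ Finset.range T, (if n < N ∨ ∑ τ ∈ Finset.range n, a τ < X then a n else 0) ≤ X + K := by
  have hle : ∀ T, ∑ n ∈ Finset.range T,
      (if n < N ∨ ∑ τ ∈ Finset.range n, a τ < X then a n else 0) ≤ ∑ n ∈ Finset.range T, a n :=
    fun T => Finset.sum_le_sum fun n _ => ite_le_sup _ _ _ |>.trans (sup_le le_rfl (ha0 n))
  induction T with
  | zero => simpa using add_nonneg hX ((ha0 0).trans (haK 0))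
  | succ T ih =>
    rcases lt_or_ge T N with hT | hT
    · calc _ ≤ ∑ n ∈ Finset.range (T + 1), a n := hle _
        _ ≤ ∑ n ∈ Finset.range N, a n :=
          Finset.sum_le_sum_of_subset_of_nonneg (Finset.range_mono hT) fun n _ _ => ha0 n
        _ ≤ X + K := by linarith
    · rw [Finset.sum_range_succ]
      split_ifs with h
      · linarith [hle T, haK T, h.resolve_left hT.not_gt]
      · simpa using ih

theorem one_le_timeInv {f : ℝ → ℝ} {y : ℝ} (h : ∃ s, 1 ≤ s ∧ y ≤ f s) : 1 ≤ timeInv f y :=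
  le_csInf h fun _ hs => hs.1

theorem card_filter_lt_le_timeInv {f : ℝ → ℝ} (hf : MonotoneOn f (Set.Ici 1)) {y : ℝ}
    (h : ∃ s, 1 ≤ s ∧ y ≤ f s) {N : ℕ} (hN : 2 ≤ N) (T : ℕ) :
    (((Finset.Ico N T).filter fun n : ℕ => f n < y).card : ℝ) ≤ timeInv f y - 1 := by
  have h1 := one_le_timeInv h
  have hle : ∀ n : ℕ, N ≤ n → f n < y → (n : ℝ) ≤ timeInv f y := by
    refine fun n hn hfn => le_csInf h fun s hs => le_of_not_ge fun hsn => ?_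
    have hn1 : (1 : ℝ) ≤ n := by exact_mod_cast (by omega : 1 ≤ n)
    exact (hs.2.trans (hf hs.1 hn1 hsn)).not_gt hfn
  have hsub : (Finset.Ico N T).filter (fun n : ℕ => f n < y) ⊆ Finset.Ioc 1 ⌊timeInv f y⌋₊ := by
    intro n hn
    simp only [Finset.mem_filter, Finset.mem_Ico] at hn
    exact Finset.mem_Ioc.2 ⟨by omega, Nat.le_floor (hle n hn.1.1 hn.2)⟩
  have hfloor : 1 ≤ ⌊timeInv f y⌋₊ := Nat.le_floor (by exact_mod_cast h1)
  calc (((Finset.Ico N T).filter fun n : ℕ => f n < y).card : ℝ)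
      ≤ ((Finset.Ioc 1 ⌊timeInv f y⌋₊).card : ℝ) := by exact_mod_cast Finset.card_le_card hsub
    _ = (⌊timeInv f y⌋₊ : ℝ) - 1 := by rw [Nat.card_Ioc, Nat.cast_sub hfloor, Nat.cast_one]
    _ ≤ timeInv f y - 1 := by
        gcongr
        exact Nat.floor_le (by linarith)

variable {N M : ℕ}

/-- The indicator that agent `k` selects arm `i` in round `n` though `i` is not its target. -/
def wrongInd (best : Fin M → Fin N) (sel : ℕ → Fin M → Fin N) (n : ℕ) (k : Fin M) (i : Fin N) : ℝ :=
  if sel n k = i ∧ best k ≠ i then 1 else 0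

/-- The number of selections of arm `i` in the first `T` rounds by agents whose target it is not. -/
def wrongCount (best : Fin M → Fin N) (sel : ℕ → Fin M → Fin N) (T : ℕ) (i : Fin N) : ℝ :=
  ∑ n ∈ Finset.range T, ∑ k, wrongInd best sel n k i

variable {Ω : Type*} {P : Matrix (Fin M) (Fin M) ℝ} {lam : Fin M → ℝ} {u : Fin M → Fin M → ℝ}
  {σ γ η : ℝ} {f : ℝ → ℝ} {r : ℕ → Fin N → Fin M → Ω → ℝ} {sel : ℕ → Fin M → Ω → Fin N}
  {m : Fin N → ℝ} {b : Equiv.Perm (Fin N)}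

theorem mem_errorEvent_of_ne (h : IsConsensusSpectrum P lam u) (hN : 2 ≤ N) (hMN : M ≤ N)
    (hσ : 0 < σ) (hγ : 0 < γ) (hη : 0 < gEta η) (hf : MonotoneOn f (Set.Ici 1)) (hf1 : 0 ≤ f 1)
    (hb : StrictAnti fun j => m (b j)) {ω : Ω}
    (hrun : IsSelectiveLearningRun P σ γ η f (r · · · ω) (sel · · ω)) {n T : ℕ} (hn : N ≤ n)
    (hnT : n ≤ T) {k : Fin M} (hne : b (Fin.castLE hMN k) ≠ sel n k ω)
    (hcount : explorationThreshold M σ γ η (minGap m) (f T) (Real.log T) + M * epsN lam ≤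
      ∑ τ ∈ Finset.range n, ∑ j, selInd (sel · · ω) (sel n k ω) τ j) :
    ω ∈ errorEvent P σ γ η f r sel m n k (b (Fin.castLE hMN k)) (sel n k ω) := by
  have hm : Function.Injective m := (b.injective_comp m).1 hb.injective
  have hΔ := minGap_pos hN hm
  have hn1 : (1 : ℝ) ≤ n := by exact_mod_cast (by omega : 1 ≤ n)
  have hnT' : (n : ℝ) ≤ T := by exact_mod_cast hnT
  have hlogT : 0 < Real.log T := Real.log_pos (by exact_mod_cast (by omega : 1 < T))
  have hthr : explorationThreshold M σ γ η (minGap m) (f T) (Real.log T) ≤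
      M * nHat P (sel · · ω) (sel n k ω) n k := by
    have := h.sum_le_runningConsensus (selInd_mem_Icc (sel · · ω) (sel n k ω)) n k
    rw [nHat_eq_runningConsensus]
    linarith
  have hx : 0 < nHat P (sel · · ω) (sel n k ω) n k := pos_of_mul_pos_right
    ((explorationThreshold_pos M hσ hγ hη hΔ hlogT).trans_le hthr) (Nat.cast_nonneg M)
  have hC := confWidth_le (n := n) k.pos hσ hγ hη hΔ hlogT (Real.log_le_log (by linarith) hnT')
    (hf1.trans (hf Set.self_mem_Ici hn1 hn1)) (hf hn1 (hn1.trans hnT') hnT') hx hthr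
  have hch := hrun.select n hn k
  rcases lt_or_gt_of_ne (hm.ne hne) with hlt | hlt
  · exact mem_errorEvent_of_gt hb.antitone hch hx.ne' hC hlt
  · exact mem_errorEvent_of_lt hb.antitone hch hx.ne' hC hlt

theorem wrongInd_le (h : IsConsensusSpectrum P lam u) (hN : 2 ≤ N) (hMN : M ≤ N)
    (hσ : 0 < σ) (hγ : 0 < γ) (hη : 0 < gEta η) (hf : MonotoneOn f (Set.Ici 1)) (hf1 : 0 ≤ f 1)
    (hb : StrictAnti fun j => m (b j)) {ω : Ω}
    (hrun : IsSelectiveLearningRun P σ γ η f (r · · · ω) (sel · · ω)) {n T : ℕ} (hnT : n ≤ T)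
    (k : Fin M) (i : Fin N) :
    wrongInd (fun k => b (Fin.castLE hMN k)) (sel · · ω) n k i ≤
      (if n < N ∨ ∑ τ ∈ Finset.range n, ∑ j, selInd (sel · · ω) i τ j <
        explorationThreshold M σ γ η (minGap m) (f T) (Real.log T) + M * epsN lam
        then selInd (sel · · ω) i n k else 0) +
      if N ≤ n then
        (errorEvent P σ γ η f r sel m n k (b (Fin.castLE hMN k)) i).indicator 1 ω else 0 := by
  have hind : (0 : ℝ) ≤ if N ≤ n then
      (errorEvent P σ γ η f r sel m n k (b (Fin.castLE hMN k)) i).indicator 1 ω else 0 := by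
    split_ifs
    · exact Set.indicator_nonneg (fun _ _ => zero_le_one) ω
    · exact le_rfl
  have hsel0 := (selInd_mem_Icc (sel · · ω) i n k).1
  by_cases hwrong : sel n k ω = i ∧ b (Fin.castLE hMN k) ≠ i
  swap
  · rw [wrongInd, if_neg hwrong]
    positivity
  obtain ⟨rfl, hne⟩ := hwrong
  rw [wrongInd, if_pos ⟨rfl, hne⟩]
  split_ifs with hearly hn hn
  · simpa [selInd, hn] using hind
  · simp [selInd]
  · push Not at hearly
    rw [Set.indicator_of_mem
      (mem_errorEvent_of_ne h hN hMN hσ hγ hη hf hf1 hb hrun hn hnT hne hearly.2)]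
    simp
  · exact absurd (not_le.1 hn) fun hlt => hearly (Or.inl hlt)

theorem wrongCount_le (h : IsConsensusSpectrum P lam u) (hN : 2 ≤ N) (hMN : M ≤ N)
    (hσ : 0 < σ) (hγ : 0 < γ) (hη : 0 < gEta η) (hf : MonotoneOn f (Set.Ici 1)) (hf1 : 0 ≤ f 1)
    (hb : StrictAnti fun j => m (b j)) {ω : Ω}
    (hrun : IsSelectiveLearningRun P σ γ η f (r · · · ω) (sel · · ω)) (T : ℕ) (i : Fin N) :
    wrongCount (fun k => b (Fin.castLE hMN k)) (sel · · ω) T i ≤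
      explorationThreshold M σ γ η (minGap m) (f T) (Real.log T) + M * epsN lam + M +
        ∑ n ∈ Finset.Ico N T, ∑ k : Fin M,
          (errorEvent P σ γ η f r sel m n k (b (Fin.castLE hMN k)) i).indicator 1 ω := by
  have hX : 0 ≤ explorationThreshold M σ γ η (minGap m) (f T) (Real.log T) + M * epsN lam :=
    add_nonneg (explorationThreshold_nonneg M hγ.le hη.le (Real.log_natCast_nonneg T))
      (mul_nonneg (Nat.cast_nonneg M) h.epsN_nonneg)
  have hmem := selInd_mem_Icc (sel · · ω) i
  have hearly := sum_ite_count_le (fun n => Finset.sum_nonneg fun k _ => (hmem n k).1)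
    (fun n => (Finset.sum_le_sum fun k _ => (hmem n k).2).trans (by simp)) hX
    (sum_init_selInd_le hrun.init i) T
  have hIco : Finset.Ico N T = (Finset.range T).filter (N ≤ ·) := by
    ext n
    simp [and_comm]
  rw [hIco, Finset.sum_filter]
  refine le_trans ?_ (add_le_add_left hearly _)
  rw [← Finset.sum_add_distrib]
  refine Finset.sum_le_sum fun n hn => (Finset.sum_le_sum fun k _ =>
    wrongInd_le h hN hMN hσ hγ hη hf hf1 hb hrun (Finset.mem_range.1 hn).le k i).trans_eq ?_
  rw [Finset.sum_add_distrib]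
  congr 1 <;> split_ifs <;> simp

end WrongCount

section ExpectedWrongCount

variable {N M : ℕ} {Ω : Type*} {r : ℕ → Fin N → Fin M → Ω → ℝ} {sel : ℕ → Fin M → Ω → Fin N}

theorem DependsOnPast.measurable_comp (hsel : DependsOnPast r sel) (n : ℕ)
    (F : (Fin M → Fin N) → ℝ) : Measurable[pastRewards r n] fun ω => F (sel n · ω) := by
  let _ : MeasurableSpace Ω := pastRewards r n
  exact (Measurable.of_discrete (f := F)).comp (measurable_pi_lambda _ fun k => hsel n k)

variable [MeasurableSpace Ω] {μ : Measure Ω}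

theorem DependsOnPast.integrable_comp [IsFiniteMeasure μ] (hsel : DependsOnPast r sel)
    (hr : ∀ n i k, Measurable (r n i k)) (n : ℕ) (F : (Fin M → Fin N) → ℝ) :
    Integrable (fun ω => F (sel n · ω)) μ :=
  .of_bound ((hsel.measurable_comp n F).mono (pastRewards_le hr n) le_rfl).aestronglyMeasurable
    (∑ x, |F x|) (.of_forall fun _ => Finset.single_le_sum (f := fun x => |F x|)
      (fun _ _ => abs_nonneg _) (Finset.mem_univ _))

theorem DependsOnPast.integrable_wrongCount [IsFiniteMeasure μ] (hsel : DependsOnPast r sel)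
    (hr : ∀ n i k, Measurable (r n i k)) (best : Fin M → Fin N) (T : ℕ) (i : Fin N) :
    Integrable (fun ω => wrongCount best (sel · · ω) T i) μ :=
  integrable_finsetSum _ fun n _ => integrable_finsetSum _ fun k _ =>
    hsel.integrable_comp hr n fun x => wrongInd best (fun _ => x) 0 k i

variable [IsProbabilityMeasure μ] {P : Matrix (Fin M) (Fin M) ℝ} {lam : Fin M → ℝ}
  {u : Fin M → Fin M → ℝ} {σ γ η : ℝ} {f : ℝ → ℝ} {law : Fin N → Measure ℝ} {m : Fin N → ℝ}
  {b : Equiv.Perm (Fin N)}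

theorem measureReal_errorEvent_le_ite_add (h : IsConsensusSpectrum P lam u) (hN : 2 ≤ N)
    (hMN : M ≤ N) (hσ : 0 < σ) (hγ : 0 ≤ γ) (hη : η ∈ Set.Ioo 0 4)
    (hr : IsRewardModel μ law m σ r) (hsel : DependsOnPast r sel)
    (hinit : ∀ ω, ∀ n < N, ∀ k, (sel n k ω : ℕ) = (n + k) % N) {n : ℕ} (hn : N ≤ n)
    (k : Fin M) (a i : Fin N) :
    μ.real (errorEvent P σ γ η f r sel m n k a i) ≤ (if f n < epsC lam u k then 1 else 0) +
      (N + 1) * ((2 * Real.log n / Real.log (1 + η) + 1) * (1 / (n : ℝ) ^ γ)) := by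
  have hlog : 0 < Real.log (1 + η) := Real.log_pos (by linarith [hη.1])
  have := Real.log_natCast_nonneg n
  split_ifs with hf
  · exact measureReal_le_one.trans (le_add_of_nonneg_right (by positivity))
  · rw [zero_add]
    exact measureReal_errorEvent_le (by positivity) (fun j s hs =>
      measure_deviation_le h hN hMN hσ hγ hη hr hsel hinit hn (not_lt.1 hf) j hs) a i

theorem sum_measureReal_errorEvent_le (h : IsConsensusSpectrum P lam u) (hN : 2 ≤ N)
    (hMN : M ≤ N) (hσ : 0 < σ) (hγ : 1 < γ) (hη : η ∈ Set.Ioo 0 4)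
    (hf : MonotoneOn f (Set.Ici 1)) (hf_inv : ∀ k, ∃ s, 1 ≤ s ∧ epsC lam u k ≤ f s)
    (hr : IsRewardModel μ law m σ r) (hsel : DependsOnPast r sel)
    (hinit : ∀ ω, ∀ n < N, ∀ k, (sel n k ω : ℕ) = (n + k) % N) (best : Fin M → Fin N) (T : ℕ)
    (i : Fin N) :
    ∑ n ∈ Finset.Ico N T, ∑ k, μ.real (errorEvent P σ γ η f r sel m n k (best k) i) ≤
      ∑ k, (timeInv f (epsC lam u k) - 1) + M * (N + 1) * (2 / Real.log (1 + η) *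
        (1 / (γ - 1) ^ 2 + γ * Real.log (1 + η) / (γ - 1) + 1)) := by
  set p : ℕ → ℝ := fun n => (2 * Real.log n / Real.log (1 + η) + 1) * (1 / (n : ℝ) ^ γ)
  calc ∑ n ∈ Finset.Ico N T, ∑ k, μ.real (errorEvent P σ γ η f r sel m n k (best k) i)
      ≤ ∑ n ∈ Finset.Ico N T, ∑ k,
          ((if f n < epsC lam u k then 1 else 0) + (N + 1) * p n) := by
        gcongr with n hn k
        exact measureReal_errorEvent_le_ite_add h hN hMN hσ (by linarith) hη hr hsel hinit
          (Finset.mem_Ico.1 hn).1 k (best k) i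
    _ = ∑ k, (((Finset.Ico N T).filter fun n : ℕ => f n < epsC lam u k).card : ℝ) +
          M * (N + 1) * ∑ n ∈ Finset.Ico N T, p n := by
        simp only [Finset.sum_add_distrib, Finset.sum_const, Finset.card_univ, Fintype.card_fin,
          nsmul_eq_mul, ← Finset.mul_sum, mul_assoc]
        rw [Finset.sum_comm]
        simp only [Finset.sum_boole]
    _ ≤ _ := by
        gcongr with k
        · exact card_filter_lt_le_timeInv hf (hf_inv k) hN T
        · exact sum_peeling_le hγ hη.1 hN T

theorem integral_wrongCount_le_add_sum (h : IsConsensusSpectrum P lam u) (hN : 2 ≤ N)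
    (hMN : M ≤ N) (hσ : 0 < σ) (hγ : 0 < γ) (hη : 0 < gEta η) (hf : MonotoneOn f (Set.Ici 1))
    (hf1 : 0 ≤ f 1) (hb : StrictAnti fun j => m (b j)) (hr : ∀ n i k, Measurable (r n i k))
    (hsel : DependsOnPast r sel)
    (hrun : ∀ ω, IsSelectiveLearningRun P σ γ η f (r · · · ω) (sel · · ω)) (T : ℕ) (i : Fin N) :
    ∫ ω, wrongCount (fun k => b (Fin.castLE hMN k)) (sel · · ω) T i ∂μ ≤
      explorationThreshold M σ γ η (minGap m) (f T) (Real.log T) + M * epsN lam + M +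
        ∑ n ∈ Finset.Ico N T, ∑ k : Fin M,
          μ.real (errorEvent P σ γ η f r sel m n k (b (Fin.castLE hMN k)) i) := by
  have hE := measurableSet_errorEvent (P := P) hr hsel σ γ η f m
  have hind : ∀ n k, Integrable ((errorEvent P σ γ η f r sel m n k
      (b (Fin.castLE hMN k)) i).indicator (1 : Ω → ℝ)) μ :=
    fun n k => (integrable_const (1 : ℝ)).indicator (hE n k _ i)
  have hsum : Integrable (fun ω => ∑ n ∈ Finset.Ico N T, ∑ k : Fin M,
      (errorEvent P σ γ η f r sel m n k (b (Fin.castLE hMN k)) i).indicator (1 : Ω → ℝ) ω) μ :=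
    integrable_finsetSum _ fun n _ => integrable_finsetSum _ fun k _ => hind n k
  refine (integral_mono (hsel.integrable_wrongCount hr _ T i) ((integrable_const _).add hsum)
    fun ω => wrongCount_le h hN hMN hσ hγ hη hf hf1 hb (hrun ω) T i).trans_eq ?_
  rw [integral_add' (integrable_const _) hsum, integral_const, probReal_univ, one_smul,
    integral_finsetSum _ fun n _ => integrable_finsetSum _ fun k _ => hind n k]
  simp only [integral_finsetSum _ fun k _ => hind _ k, integral_indicator_one (hE _ _ _ i)]

theorem integral_wrongCount_le (h : IsConsensusSpectrum P lam u) (hN : 2 ≤ N) (hMN : M ≤ N)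
    (hσ : 0 < σ) (hγ : 1 < γ) (hη : η ∈ Set.Ioo 0 4) (hf : MonotoneOn f (Set.Ici 1))
    (hf1 : 0 ≤ f 1) (hf_inv : ∀ k, ∃ s, 1 ≤ s ∧ epsC lam u k ≤ f s)
    (hb : StrictAnti fun j => m (b j)) (hr : IsRewardModel μ law m σ r)
    (hsel : DependsOnPast r sel)
    (hrun : ∀ ω, IsSelectiveLearningRun P σ γ η f (r · · · ω) (sel · · ω)) (T : ℕ) (i : Fin N) :
    ∫ ω, wrongCount (fun k => b (Fin.castLE hMN k)) (sel · · ω) T i ∂μ ≤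
      boundB N M σ γ η f (minGap m) (epsN lam) (fun k => timeInv f (epsC lam u k)) T := by
  have hε := h.epsN_nonneg
  have hlog : 0 < Real.log (1 + η) := Real.log_pos (by linarith [hη.1])
  have hlog_le : Real.log (1 + η) ≤ Real.log ((1 + epsN lam) * (1 + η)) :=
    Real.log_le_log (by linarith [hη.1]) (le_mul_of_one_le_left (by linarith [hη.1]) (by linarith))
  set A := explorationThreshold M σ γ η (minGap m) (f T) (Real.log T)
  calc ∫ ω, wrongCount (fun k => b (Fin.castLE hMN k)) (sel · · ω) T i ∂μ
      ≤ A + M * epsN lam + M + ∑ n ∈ Finset.Ico N T, ∑ k : Fin M,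
          μ.real (errorEvent P σ γ η f r sel m n k (b (Fin.castLE hMN k)) i) :=
        integral_wrongCount_le_add_sum h hN hMN hσ (by linarith) (gEta_pos hη) hf hf1 hb
          hr.measurable hsel hrun T i
    _ ≤ A + M * epsN lam + M + (∑ k, (timeInv f (epsC lam u k) - 1) +
          M * (N + 1) * (2 / Real.log (1 + η) *
            (1 / (γ - 1) ^ 2 + γ * Real.log ((1 + epsN lam) * (1 + η)) / (γ - 1) + 1))) := by
        have : 0 < γ - 1 := by linarith
        grw [sum_measureReal_errorEvent_le h hN hMN hσ hγ hη hf hf_inv hr hsel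
          (fun ω => (hrun ω).init) _ T i]
        gcongr
    _ = A + lBar N M γ η (epsN lam) (fun k => timeInv f (epsC lam u k)) - 1 := by
        rw [lBar]
        ring
    _ ≤ _ := by
        rw [boundB, ← explorationThreshold]
        linarith

end ExpectedWrongCount

/-! ### Regret -/

section Regret

variable {N M : ℕ} {m : Fin N → ℝ} {best : Fin M → Fin N}

/-- The mean reward that agent `k` receives in round `n`: nothing if its arm is contested. -/
def payoff (m : Fin N → ℝ) (sel : ℕ → Fin M → Fin N) (n : ℕ) (k : Fin M) : ℝ :=
  m (sel n k) * soleInd sel n k (sel n k)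

theorem soleInd_nonneg (sel : ℕ → Fin M → Fin N) (n : ℕ) (k : Fin M) (i : Fin N) :
    0 ≤ soleInd sel n k i := by
  unfold soleInd
  positivity

theorem wrongInd_nonneg (best : Fin M → Fin N) (sel : ℕ → Fin M → Fin N) (n : ℕ) (k : Fin M)
    (i : Fin N) : 0 ≤ wrongInd best sel n k i := by
  unfold wrongInd
  positivity

theorem sub_payoff_le (hbest : Function.Injective best) (hm : ∀ i, 0 ≤ m i)
    (sel : ℕ → Fin M → Fin N) (n : ℕ) (k : Fin M) :
    m (best k) - payoff m sel n k ≤ m (best k) * ∑ i, wrongInd best sel n k i +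
      m (best k) * ∑ j, wrongInd best sel n j (best k) := by
  have hpay : 0 ≤ payoff m sel n k := mul_nonneg (hm _) (soleInd_nonneg sel n k _)
  have hown : 0 ≤ ∑ i, wrongInd best sel n k i :=
    Finset.sum_nonneg fun i _ => wrongInd_nonneg best sel n k i
  have hother : 0 ≤ ∑ j, wrongInd best sel n j (best k) :=
    Finset.sum_nonneg fun j _ => wrongInd_nonneg best sel n j (best k)
  rw [← mul_add]
  by_cases hsole : sel n k = best k ∧ ∀ j, j ≠ k → sel n j ≠ best k
  · have hpay_eq : payoff m sel n k = m (best k) := by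
      rw [payoff, hsole.1, soleInd, if_pos hsole, mul_one]
    rw [hpay_eq, sub_self]
    exact mul_nonneg (hm _) (add_nonneg hown hother)
  suffices 1 ≤ ∑ i, wrongInd best sel n k i + ∑ j, wrongInd best sel n j (best k) by
    linarith [le_mul_of_one_le_right (hm (best k)) this]
  by_cases hk : sel n k = best k
  · obtain ⟨j, hjk, hj⟩ : ∃ j, j ≠ k ∧ sel n j = best k := by
      simpa [hk] using hsole
    have hwrong : wrongInd best sel n j (best k) = 1 := if_pos ⟨hj, hbest.ne hjk⟩
    have := Finset.single_le_sum (fun j _ => wrongInd_nonneg best sel n j (best k))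
      (Finset.mem_univ j)
    linarith
  · have hwrong : wrongInd best sel n k (sel n k) = 1 := if_pos ⟨rfl, Ne.symm hk⟩
    have := Finset.single_le_sum (fun i _ => wrongInd_nonneg best sel n k i)
      (Finset.mem_univ (sel n k))
    linarith

theorem sum_sub_payoff_le (hbest : Function.Injective best) (hm : ∀ i, 0 ≤ m i) {top : ℝ}
    (htop : ∀ i, m i ≤ top) (sel : ℕ → Fin M → Fin N) (T : ℕ) :
    ∑ n ∈ Finset.range T, ∑ k, (m (best k) - payoff m sel n k) ≤
      top * ∑ i, wrongCount best sel T i +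
        ∑ k, m (best k) * wrongCount best sel T (best k) := by
  calc ∑ n ∈ Finset.range T, ∑ k, (m (best k) - payoff m sel n k)
      ≤ ∑ n ∈ Finset.range T, ∑ k, (top * ∑ i, wrongInd best sel n k i +
          m (best k) * ∑ j, wrongInd best sel n j (best k)) := by
        gcongr with n _ k
        refine (sub_payoff_le hbest hm sel n k).trans ?_
        gcongr
        · exact Finset.sum_nonneg fun i _ => wrongInd_nonneg best sel n k i
        · exact htop _
    _ = _ := by
        simp only [wrongCount, Finset.sum_add_distrib, ← Finset.mul_sum]
        congr 1
        · rw [Finset.sum_comm (s := Finset.univ)]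
          simp only [Finset.sum_comm (s := (Finset.univ : Finset (Fin N)))]
        · rw [Finset.sum_comm]
          simp only [Finset.mul_sum]

variable {Ω : Type*} [MeasurableSpace Ω] {μ : Measure Ω} {r : ℕ → Fin N → Fin M → Ω → ℝ}
  {sel : ℕ → Fin M → Ω → Fin N} {law : Fin N → Measure ℝ} {σ : ℝ}

theorem IsRewardModel.integrable (hr : IsRewardModel μ law m σ r) (n : ℕ) (i : Fin N)
    (k : Fin M) : Integrable (r n i k) μ :=
  (integrable_map_measure aestronglyMeasurable_id (hr.measurable n i k).aemeasurable).1
    (hr.map_eq n i k ▸ (hr.isSubGaussianLaw i).integrable)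

theorem IsRewardModel.integral_eq (hr : IsRewardModel μ law m σ r) (n : ℕ) (i : Fin N)
    (k : Fin M) : ∫ ω, r n i k ω ∂μ = m i := by
  rw [hr.mean_eq, ← hr.map_eq n i k]
  exact (integral_map (hr.measurable n i k).aemeasurable aestronglyMeasurable_id).symm

theorem IsRewardModel.indepFun_comp (hr : IsRewardModel μ law m σ r) (hsel : DependsOnPast r sel)
    (n : ℕ) (i : Fin N) (k : Fin M) (F : (Fin M → Fin N) → ℝ) :
    IndepFun (r n i k) (fun ω => F (sel n · ω)) μ :=
  IndepFun.symm <| (IndepFun_iff_Indep _ _ μ).2 <|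
    indep_of_indep_of_le_left (indep_of_indep_of_le_right
      (indep_iSup_lt (rewardSigma_le hr.measurable) hr.iIndep_rewardSigma (toLex (n, k)))
      (measurable_rewardSigma n i k).comap_le)
      ((hsel.measurable_comp n F).comap_le.trans (pastRewards_le_iSup_lt n k))

theorem IsRewardModel.integral_received [IsProbabilityMeasure μ]
    (hr : IsRewardModel μ law m σ r) (hsel : DependsOnPast r sel) (n : ℕ) (k : Fin M) :
    ∫ ω, ∑ i, r n i k ω * (if sel n k ω = i then 1 else 0) * soleInd (sel · · ω) n k i ∂μ =
      ∫ ω, payoff m (sel · · ω) n k ∂μ := by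
  let F (i : Fin N) (x : Fin M → Fin N) : ℝ :=
    (if x k = i then 1 else 0) * soleInd (fun _ => x) n k i
  have hF := fun i => hsel.integrable_comp (μ := μ) hr.measurable n (F i)
  have hind := fun i => hr.indepFun_comp hsel n i k (F i)
  have hmul : ∀ i, Integrable (fun ω => r n i k ω * F i (sel n · ω)) μ :=
    fun i => (hind i).integrable_mul (hr.integrable n i k) (hF i)
  calc ∫ ω, ∑ i, r n i k ω * (if sel n k ω = i then 1 else 0) * soleInd (sel · · ω) n k i ∂μ
      = ∫ ω, ∑ i, r n i k ω * F i (sel n · ω) ∂μ := by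
        simp only [F, mul_assoc, soleInd]
    _ = ∑ i, m i * ∫ ω, F i (sel n · ω) ∂μ := by
        rw [integral_finsetSum _ fun i _ => hmul i]
        refine Finset.sum_congr rfl fun i _ => ?_
        rw [(hind i).integral_fun_mul_eq_mul_integral (hr.integrable n i k).aestronglyMeasurable
          (hF i).aestronglyMeasurable, hr.integral_eq]
    _ = ∫ ω, ∑ i, m i * F i (sel n · ω) ∂μ := by
        rw [integral_finsetSum _ fun i _ => (hF i).const_mul _]
        simp only [integral_const_mul]
    _ = _ := by
        refine integral_congr_ae (.of_forall fun ω => ?_)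
        simp only [F, payoff, ite_mul, one_mul, zero_mul, mul_ite, mul_zero, Finset.sum_ite_eq,
          Finset.mem_univ, if_true]
        rfl

theorem DependsOnPast.integrable_payoff [IsFiniteMeasure μ] (hsel : DependsOnPast r sel)
    (hr : ∀ n i k, Measurable (r n i k)) (m : Fin N → ℝ) (n : ℕ) (k : Fin M) :
    Integrable (fun ω => payoff m (sel · · ω) n k) μ :=
  hsel.integrable_comp hr n fun x => payoff m (fun _ => x) n k

theorem groupRegret_eq (μ : Measure Ω) (m : Fin N → ℝ) (best : Fin M → Fin N)
    (sel : ℕ → Fin M → Ω → Fin N) (T : ℕ) :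
    groupRegret μ m best sel T = T * ∑ k, m (best k) -
      ∫ ω, ∑ n ∈ Finset.range T, ∑ k, payoff m (sel · · ω) n k ∂μ :=
  rfl

theorem IsRewardModel.groupRegret_eq_sum_agentRegret [IsProbabilityMeasure μ]
    (hr : IsRewardModel μ law m σ r) (hsel : DependsOnPast r sel) (T : ℕ) :
    groupRegret μ m best sel T = ∑ k, agentRegret μ m best r sel T k := by
  have hpay := hsel.integrable_payoff (μ := μ) hr.measurable m
  simp only [agentRegret, hr.integral_received hsel]
  rw [groupRegret_eq, Finset.sum_comm,
    integral_finsetSum _ fun n _ => integrable_finsetSum _ fun k _ => hpay n k]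
  simp only [integral_finsetSum _ fun k _ => hpay _ k, Finset.sum_sub_distrib, Finset.sum_const,
    Finset.card_range, nsmul_eq_mul]

theorem groupRegret_le [IsProbabilityMeasure μ] (hbest : Function.Injective best)
    (hm : ∀ i, 0 ≤ m i) {top : ℝ} (htop : ∀ i, m i ≤ top)
    (hr : ∀ n i k, Measurable (r n i k)) (hsel : DependsOnPast r sel) (T : ℕ) :
    groupRegret μ m best sel T ≤ top * ∑ i, ∫ ω, wrongCount best (sel · · ω) T i ∂μ +
      ∑ k, m (best k) * ∫ ω, wrongCount best (sel · · ω) T (best k) ∂μ := by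
  have hpay : Integrable (fun ω => ∑ n ∈ Finset.range T, ∑ k, payoff m (sel · · ω) n k) μ :=
    integrable_finsetSum _ fun n _ => integrable_finsetSum _ fun k _ =>
      hsel.integrable_payoff hr m n k
  have hwrong := hsel.integrable_wrongCount (μ := μ) hr best T
  have hall := (integrable_finsetSum Finset.univ fun i _ => hwrong i).const_mul top
  have htarget := integrable_finsetSum Finset.univ fun k _ =>
    (hwrong (best k)).const_mul (m (best k))
  calc groupRegret μ m best sel T
      = ∫ ω, (T * ∑ k, m (best k) -
          ∑ n ∈ Finset.range T, ∑ k, payoff m (sel · · ω) n k) ∂μ := by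
        rw [groupRegret_eq, integral_sub (integrable_const _) hpay, integral_const, probReal_univ,
          one_smul]
    _ ≤ ∫ ω, (top * ∑ i, wrongCount best (sel · · ω) T i +
          ∑ k, m (best k) * wrongCount best (sel · · ω) T (best k)) ∂μ := by
        refine integral_mono ((integrable_const _).sub hpay) (hall.add htarget) fun ω => ?_
        simpa [Finset.sum_sub_distrib] using sum_sub_payoff_le hbest hm htop (sel · · ω) T
    _ = _ := by
        rw [integral_add hall htarget, integral_const_mul,
          integral_finsetSum _ fun i _ => hwrong i,
          integral_finsetSum _ fun k _ => (hwrong (best k)).const_mul _]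
        simp only [integral_const_mul]

end Regret

end CoopBandit

theorem corollary2_general {Ω : Type*} [MeasurableSpace Ω] {μ : Measure Ω} [IsProbabilityMeasure μ]
    {N M : ℕ} (hN : 2 ≤ N) (hMN : M ≤ N) {P : Matrix (Fin M) (Fin M) ℝ} {lam : Fin M → ℝ}
    {u : Fin M → Fin M → ℝ} (h : CoopBandit.IsConsensusSpectrum P lam u) {σ γ η : ℝ} (hσ : 0 < σ)
    (hγ : 1 < γ) (hη : η ∈ Set.Ioo 0 4) {f : ℝ → ℝ} (hf : MonotoneOn f (Set.Ici 1))
    (hf1 : 0 ≤ f 1) (hf_inv : ∀ k, ∃ s, 1 ≤ s ∧ CoopBandit.epsC lam u k ≤ f s)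
    {law : Fin N → Measure ℝ} {m : Fin N → ℝ} (hm : ∀ i, 0 ≤ m i) {b : Equiv.Perm (Fin N)}
    (hb : StrictAnti fun j => m (b j)) {r : ℕ → Fin N → Fin M → Ω → ℝ}
    (hr : CoopBandit.IsRewardModel μ law m σ r) {sel : ℕ → Fin M → Ω → Fin N}
    (hsel : CoopBandit.DependsOnPast r sel)
    (hrun : ∀ ω, CoopBandit.IsSelectiveLearningRun P σ γ η f (r · · · ω) (sel · · ω)) {T : ℕ}
    (_ : 1 ≤ T) :
    let best : Fin M → Fin N := fun k => b (Fin.castLE hMN k)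
    let B : ℝ := CoopBandit.boundB N M σ γ η f (CoopBandit.minGap m) (CoopBandit.epsN lam)
      (fun k => CoopBandit.timeInv f (CoopBandit.epsC lam u k)) T
    CoopBandit.groupRegret μ m best sel T = ∑ k, CoopBandit.agentRegret μ m best r sel T k ∧
      ∑ k, CoopBandit.agentRegret μ m best r sel T k ≤
        m (b ⟨0, two_pos.trans_le hN⟩) * N * B + ∑ k, m (best k) * B := by
  intro best B
  have hbest : Function.Injective best := b.injective.comp (Fin.castLE_injective hMN)
  have htop : ∀ i, m i ≤ m (b ⟨0, two_pos.trans_le hN⟩) := fun i => by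
    simpa using hb.antitone (Fin.mk_le_of_le_val (Nat.zero_le (b.symm i)))
  have hcount := CoopBandit.integral_wrongCount_le h hN hMN hσ hγ hη hf hf1 hf_inv hb hr hsel hrun T
  have hregret := hr.groupRegret_eq_sum_agentRegret (best := best) hsel T
  refine ⟨hregret, hregret ▸ ?_⟩
  calc CoopBandit.groupRegret μ m best sel T
      ≤ m (b ⟨0, two_pos.trans_le hN⟩) * ∑ i, ∫ ω, CoopBandit.wrongCount best (sel · · ω) T i ∂μ +
          ∑ k, m (best k) * ∫ ω, CoopBandit.wrongCount best (sel · · ω) T (best k) ∂μ :=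
        CoopBandit.groupRegret_le hbest hm htop hr.measurable hsel T
    _ ≤ m (b ⟨0, two_pos.trans_le hN⟩) * ∑ _i : Fin N, B + ∑ k, m (best k) * B := by
        gcongr
        · exact hm _
        · exact hcount _
        · exact hm _
        · exact hcount _
    _ = m (b ⟨0, two_pos.trans_le hN⟩) * N * B + ∑ k, m (best k) * B := by
        simp [mul_assoc]

theorem corollary2
    {Ω : Type*} [MeasurableSpace Ω] (μ : Measure Ω) [IsProbabilityMeasure μ]
    -- `N` arms and `M ≤ N` agents
    {N M : ℕ} (hN : 2 ≤ N) (hMN : M ≤ N)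
    -- connected communication graph, consensus matrix and its spectrum
    (G : SimpleGraph (Fin M)) [DecidableRel G.Adj] (hG : G.Connected)
    (κ : ℝ) (hκ0 : 0 < κ) (hκ1 : κ ≤ 1)
    (lam : Fin M → ℝ) (u : Fin M → Fin M → ℝ)
    (hspec : CoopBandit.IsEigenbasis (CoopBandit.consensusMatrix G κ) lam u)
    (hlam : ∀ p, -1 < lam p)
    -- parameters of the algorithm
    (σ γ η : ℝ) (hσ : 0 < σ) (hγ : 1 < γ) (hη0 : 0 < η) (hη4 : η < 4)
    (f : ℝ → ℝ) (hf_mono : StrictMonoOn f (Set.Ici 1)) (hf_nonneg : 0 ≤ f 1)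
    (hf_sublog : f =o[Filter.atTop] Real.log)
    (hf_inv : ∀ k, ∃ s, 1 ≤ s ∧ CoopBandit.epsC lam u k ≤ f s)
    -- reward distributions, with nonnegative and pairwise different means
    (law : Fin N → Measure ℝ) (hlaw : ∀ i, CoopBandit.IsSubGaussianLaw (law i) σ)
    (m : Fin N → ℝ) (hm : ∀ i, m i = ∫ x, x ∂(law i)) (hm_nonneg : ∀ i, 0 ≤ m i)
    (b : Equiv.Perm (Fin N)) (hb : StrictAnti fun j => m (b j))
    -- rewards, independent over rounds and agents
    (r : ℕ → Fin N → Fin M → Ω → ℝ) (hr_meas : ∀ n i k, Measurable (r n i k))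
    (hr_law : ∀ n i k, μ.map (r n i k) = law i)
    (hr_indep : iIndepFun (fun (q : ℕ × Fin M) ω i => r q.1 i q.2 ω) μ)
    -- selections made by the algorithm on the basis of the past
    (sel : ℕ → Fin M → Ω → Fin N)
    (hsel_past : CoopBandit.DependsOnPast r sel)
    (hsel : ∀ ω, CoopBandit.IsSelectiveLearningRun (CoopBandit.consensusMatrix G κ) σ γ η f
      (fun n i k => r n i k ω) (fun n k => sel n k ω))
    (T : ℕ) (hT : 1 ≤ T) :
    let best : Fin M → Fin N := fun k => b (Fin.castLE hMN k)
    let B : ℝ := CoopBandit.boundB N M σ γ η f (CoopBandit.minGap m) (CoopBandit.epsN lam)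
      (fun k => CoopBandit.timeInv f (CoopBandit.epsC lam u k)) T
    CoopBandit.groupRegret μ m best sel T ≤ ∑ k, CoopBandit.agentRegret μ m best r sel T k ∧
      ∑ k, CoopBandit.agentRegret μ m best r sel T k ≤
        m (b ⟨0, by omega⟩) * N * B + ∑ k, m (best k) * B := by
  exact (corollary2_general hN hMN (hspec.isConsensusSpectrum hG hκ0 hκ1 hlam) hσ hγ
    ⟨hη0, hη4⟩ hf_mono.monotoneOn hf_nonneg hf_inv hm_nonneg hb
    ⟨hr_meas, hr_law, hm, hlaw, hr_indep⟩ hsel_past hsel hT).imp_left Eq.le
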